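/- Let $\mathbf k$ be a commutative $\mathbb Q$-algebra. **The algebras.** Let $F_2$ be the free group on $X_0,X_1$, let $I\subset\mathbf kF_2$ be the augmentation ideal, and set $$\mathcal W_l^{\mathrm B}:=\mathbf k1+\mathbf kF_2(X_1-1),\qquad (\mathcal W_l^{\mathrm B})_+:=\mathbf kF_2(X_1-1),\qquad \mathcal W_r^{\mathrm B}:=\mathbf k1+(X_1-1)\mathbf kF_2 ,$$ subalgebras of $\mathbf kF_2$ (the second one non-unital). Let $(\mathbf kF_2,\cdot_{X_1-1})$ be $\mathbf kF_2$ with the product $f\cdot_{X_1-1}g:=f(X_1-1)g$, and let $\mathrm{mor}^l:(\mathbf kF_2,\cdot_{X_1-1})\to(\mathcal W_l^{\mathrm B})_+$ be the algebra morphism $f\mapsto f(X_1-1)$. Let $\mathrm{Ad}(X_1-1):\mathcal W_l^{\mathrm B}\to\mathcal W_r^{\mathrm B}$ be the algebra morphism $1\mapsto1$, $a(X_1-1)\mapsto(X_1-1)a$. **The coproduct.** For each sign and each $n\ge1$ put $Y_n^{\pm}:=(X_0^{\pm1}-1)^{n-1}X_0^{\pm1}(1-X_1^{\pm1})\in\mathcal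 W_l^{\mathrm B}$. There is a unique algebra morphism $\underline\Delta_\sharp:\mathcal W_l^{\mathrm B}\to(\mathcal W_l^{\mathrm B})^{\otimes2}$ such that $$\underline\Delta_\sharp(X_1^{\pm1})=X_1^{\pm1}\otimes X_1^{\pm1},\qquad \underline\Delta_\sharp(Y_n^\pm)=Y_n^\pm\otimes1+1\otimes Y_n^\pm+\sum_{i=1}^{n-1}Y_i^\pm\otimes Y_{n-i}^\pm\quad(n\ge1).$$ Set $\underline\Delta_\sharp^{l,r}:=\mathrm{Ad}(X_1-1)^{\otimes2}\circ\underline\Delta_\sharp:\mathcal W_l^{\mathrm B}\to(\mathcal W_r^{\mathrm B})^{\otimes2}$. In the tensor squares write $X_1:=X_1\otimes1$ and $Y_1:=1\otimes X_1$; $\mathrm{Ad}(Y_1^{-1})$ is the conjugation $x\mapsto Y_1^{-1}xY_1$ of $(\mathcal W_r^{\mathrm B})^{\otimes2}$. **The group $P_5^*$.** Let $P_5^*$ be the pure modular group of the sphere with five marked points, that is, the quotient of the pure Artin braid group $K_4$ by its center. Write $(a,b)=aba^{-1}b^{-1}$. Then $P_5^*$ is presented by generators $x_{ij}$, $1\le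 i<j\le4$, and relations: $x_{ij}x_{ik}x_{jk}$ commutes with $x_{ij},x_{ik},x_{jk}$ for all $i<j<k$; $(x_{12},x_{34})=(x_{14},x_{23})=(x_{13},x_{12}^{-1}x_{24}x_{12})=1$; and $x_{12}\cdot x_{13}x_{23}\cdot x_{14}x_{24}x_{34}=1$. Set $$x_{15}:=(x_{12}x_{13}x_{14})^{-1},\quad x_{25}:=(x_{12}x_{23}x_{24})^{-1},\quad x_{35}:=(x_{13}x_{23}x_{34})^{-1}.$$ Let $\underline\ell:\mathbf kF_2\to\mathbf kP_5^*$ be the algebra morphism induced by the group morphism $X_0\mapsto x_{23}$, $X_1\mapsto x_{12}$, and let $\mathrm{pr}_1,\mathrm{pr}_2,\mathrm{pr}_5:P_5^*\to F_2$ be the group morphisms | | $x_{12}$ | $x_{13}$ | $x_{14}$ | $x_{23}$ | $x_{24}$ | $x_{34}$ | |---|---|---|---|---|---|---| | $\mathrm{pr}_1$ | $1$ | $1$ | $1$ | $X_0$ | $(X_1X_0)^{-1}$ | $X_1$ | | $\mathrm{pr}_2$ | $1$ | $(X_0X_1)^{-1}$ | $X_0$ | $1$ | $1$ | $X_1$ |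 | $\mathrm{pr}_5$ | $X_1$ | $(X_0X_1)^{-1}$ | $X_0$ | $X_0$ | $(X_1X_0)^{-1}$ | $X_1$ | Let $\underline{\mathrm{pr}}_{12}:\mathbf kP_5^*\to(\mathbf kF_2)^{\otimes2}$ be the algebra morphism given by $g\mapsto\mathrm{pr}_1(g)\otimes\mathrm{pr}_2(g)$ on $P_5^*$, and $M_3(\underline{\mathrm{pr}}_{12})$ its entrywise extension to $3\times3$ matrices. Let $J:=\mathrm{Ker}(\underline{\mathrm{pr}}_5:\mathbf kP_5^*\to\mathbf kF_2)$, a two-sided ideal. It is free as a left $\mathbf kP_5^*$-module with basis $(x_{i5}-1)_{i=1,2,3}$, and $\underline\varpi:\mathbf kP_5^*\to M_3(\mathbf kP_5^*)$ is the algebra morphism determined by $$(x_{i5}-1)\,p=\sum_{j=1}^3\underline\varpi(p)_{ij}\,(x_{j5}-1)\qquad(p\in\mathbf kP_5^*,\ i=1,2,3).$$ Finally let $\underline{\mathrm{row}}:=(X_1-1,\ 1-Y_1,\ 0)$ and $\underline{\mathrm{col}}:={}^t(Y_1,\ -1,\ 0)$, with entries in $(\mathbf kF_2)^{\otimes2}$.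 **Proposition.** The freeness of $J$ and the existence and uniqueness of $\underline\Delta_\sharp$ asserted above hold, and the following are true. 1. $\mathrm{mor}^l$ is an isomorphism, the morphism $\mathrm{incl}:(\mathcal W_r^{\mathrm B})^{\otimes2}\to(\mathbf kF_2)^{\otimes2}$ induced by $\mathcal W_r^{\mathrm B}\subset\mathbf kF_2$ is injective, and the diagram $$\begin{array}{ccccccccc} \mathbf kF_2&\xrightarrow{\ \underline\ell\ }&\mathbf kP_5^*&\xrightarrow{\ \underline\varpi\ }&M_3(\mathbf kP_5^*)&\xrightarrow{M_3(\underline{\mathrm{pr}}_{12})}&M_3((\mathbf kF_2)^{\otimes2})&\xrightarrow[\ \diamond\ ]{\underline{\mathrm{row}}\cdot(-)\cdot\underline{\mathrm{col}}}&(\mathbf kF_2)^{\otimes2}\\ {\scriptstyle\diamond}\downarrow{\scriptstyle\mathrm{id}}&&&&&&&&\\ (\mathbf kF_2,\cdot_{X_1-1})&&&&&&&&\uparrow{\scriptstyle\mathrm{incl}}\\ \downarrow{\scriptstyle\mathrm{mor}^l}&&&&&&&&\\ (\mathcal W_l^{\mathrm B})_+&&&&\xrightarrow{\ \mathrm{Ad}(Y_1^{-1})\circ\underline\Delta_\sharp^{l,r}\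 }&&&&(\mathcal W_r^{\mathrm B})^{\otimes2} \end{array}$$ commutes. That is, for all $f\in\mathbf kF_2$, in $(\mathbf kF_2)^{\otimes2}$, $$\mathrm{Ad}(Y_1^{-1})\bigl(\underline\Delta_\sharp^{l,r}(f(X_1-1))\bigr)=\underline{\mathrm{row}}\cdot M_3(\underline{\mathrm{pr}}_{12})\bigl(\underline\varpi(\underline\ell(f))\bigr)\cdot\underline{\mathrm{col}} .$$ All maps are algebra morphisms, except for the two marked $\diamond$, which are only $\mathbf k$-linear. 2. Filter $\mathbf kF_2$, $\mathbf kP_5^*$ and $(\mathbf kF_2)^{\otimes2}\simeq\mathbf k[F_2\times F_2]$ by the powers of their augmentation ideals; matrix algebras by $F^nM_3(A)=M_3(F^nA)$; $(\mathcal W_l^{\mathrm B})_+$ and $\mathcal W_r^{\mathrm B}$ by the filtration induced from $\mathbf kF_2$; $(\mathcal W_r^{\mathrm B})^{\otimes2}$ by the tensor product filtration; and $(\mathbf kF_2,\cdot_{X_1-1})$ by $F^0=\mathbf kF_2$, $F^n=I^{n-1}$ for $n\ge1$. Then every map $u$ of the diagram satisfies $u(F^n)\subset F^n$ for all $n\ge0$,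 and the two maps marked $\diamond$ satisfy moreover $u(F^n)\subset F^{n+1}$ for all $n\ge0$. 3. Consequently every map $u$ of the diagram induces a continuous $\mathbf k$-linear map $\hat u$ between the completions $\varprojlim_n A/F^nA$, taken with the inverse limit topology. The completed diagram commutes, and $\hat u$ is multiplicative whenever $u$ is not marked $\diamond$. -/

import Mathlib

open scoped TensorProduct

noncomputable section

namespace BettiBraid

/-! ### Filtered algebras, their completions, and maps between them -/

/-- The linear map underlying a morphism of non-unital algebras. -/
def toLin {k A B : Type*} [CommRing k] [NonUnitalRing A] [Module k A] [NonUnitalRing B]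
    [Module k B] (f : A →ₙₐ[k] B) : A →ₗ[k] B where
  toFun := f
  map_add' := map_add f
  map_smul' := map_smul f

/-- A filtered (possibly non-unital) `k`-algebra: a descending sequence of submodules `F n`
with `F 0 = A` and `F m * F n ⊆ F (m + n)`. -/
structure AlgFiltration (k A : Type*) [CommRing k] [NonUnitalRing A] [Module k A] where
  sub : ℕ → Submodule k A
  sub_zero : sub 0 = ⊤
  antitone : Antitone sub
  mul_mem : ∀ m n a b, a ∈ sub m → b ∈ sub n → a * b ∈ sub (m + n)

namespace AlgFiltration

section

variable {k A B : Type*} [CommRing k] [NonUnitalRing A] [Module k A]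
  [NonUnitalRing B] [Module k B]

/-- The completion `lim A / F n`: compatible families of classes. -/
def completion (F : AlgFiltration k A) : Submodule k (∀ n, A ⧸ F.sub n) where
  carrier := {x | ∀ m n (h : m ≤ n), Submodule.factor (F.antitone h) (x n) = x m}
  add_mem' := by
    intro x y hx hy m n h
    simp [hx m n h, hy m n h]
  zero_mem' := by
    intro m n h
    simp
  smul_mem' := by
    intro c x hx m n h
    simp [hx m n h]

/-- The inverse limit topology, each quotient `A / F n` being discrete. -/
instance (F : AlgFiltration k A) : TopologicalSpace F.completion :=
  TopologicalSpace.induced (fun x => (x : ∀ n, A ⧸ F.sub n))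
    (@Pi.topologicalSpace ℕ (fun n => A ⧸ F.sub n) (fun _ => ⊥))

/-- The canonical map from a filtered algebra to its completion. -/
def toCompletion (F : AlgFiltration k A) : A →ₗ[k] F.completion where
  toFun a := ⟨fun n => (F.sub n).mkQ a, fun _ _ _ => rfl⟩
  map_add' _ _ := rfl
  map_smul' _ _ := rfl

theorem mul_mem_left (F : AlgFiltration k A) (n : ℕ) (a : A) {b : A} (hb : b ∈ F.sub n) :
    a * b ∈ F.sub n := by
  have h := F.mul_mem 0 n a b (by rw [F.sub_zero]; trivial) hb
  rwa [Nat.zero_add] at h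

theorem mul_mem_right (F : AlgFiltration k A) (n : ℕ) {a : A} (b : A) (ha : a ∈ F.sub n) :
    a * b ∈ F.sub n :=
  F.mul_mem n 0 a b ha (by rw [F.sub_zero]; trivial)

/-- The product of the quotient algebra `A / F n`. -/
def quotMul [IsScalarTower k A A] [SMulCommClass k A A] (F : AlgFiltration k A) (n : ℕ) :
    (A ⧸ F.sub n) →ₗ[k] (A ⧸ F.sub n) →ₗ[k] (A ⧸ F.sub n) :=
  (F.sub n).liftQ
    { toFun := fun a => (F.sub n).mapQ (F.sub n) (LinearMap.mul k A a)
        (fun _ hb => F.mul_mem_left n a hb)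
      map_add' := fun a b => Submodule.linearMap_qext _ (LinearMap.ext fun c =>
        congrArg (F.sub n).mkQ (add_mul a b c))
      map_smul' := fun r a => Submodule.linearMap_qext _ (LinearMap.ext fun c =>
        congrArg (F.sub n).mkQ (smul_mul_assoc r a c)) }
    (fun _ ha => Submodule.linearMap_qext _ (LinearMap.ext fun c =>
      (Submodule.Quotient.mk_eq_zero _).2 (F.mul_mem_right n c ha)))

/-- The product of the completion, computed in each quotient. -/
instance [IsScalarTower k A A] [SMulCommClass k A A] (F : AlgFiltration k A) :
    Mul F.completion where
  mul x y := ⟨fun n => F.quotMul n (x.1 n) (y.1 n), fun m n h => by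
    obtain ⟨a, ha⟩ := (F.sub n).mkQ_surjective (x.1 n)
    obtain ⟨b, hb⟩ := (F.sub n).mkQ_surjective (y.1 n)
    have hx := x.2 m n h
    have hy := y.2 m n h
    rw [← ha] at hx
    rw [← hb] at hy
    change Submodule.factor (F.antitone h) (F.quotMul n (x.1 n) (y.1 n)) =
      F.quotMul m (x.1 m) (y.1 m)
    rw [← ha, ← hb, ← hx, ← hy]
    rfl⟩

/-- `f (F n) ⊆ G (n + d)` for all `n`: the map `f` is weakly compatible with the filtrations,
with filtration shift at most `d`. -/
def HasShift (F : AlgFiltration k A) (G : AlgFiltration k B) (d : ℕ) (f : A →ₗ[k] B) : Prop :=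
  ∀ n, ∀ a ∈ F.sub n, f a ∈ G.sub (n + d)

theorem HasShift.le_comap {F : AlgFiltration k A} {G : AlgFiltration k B} {d : ℕ}
    {f : A →ₗ[k] B} (h : HasShift F G d f) (n : ℕ) : F.sub n ≤ (G.sub n).comap f :=
  fun a ha => G.antitone (Nat.le_add_right n d) (h n a ha)

/-- The continuous linear map between completions induced by a map that is weakly compatible
with the filtrations. -/
def HasShift.map {F : AlgFiltration k A} {G : AlgFiltration k B} {d : ℕ}
    {f : A →ₗ[k] B} (h : HasShift F G d f) : F.completion →L[k] G.completion where
  toFun x := ⟨fun n => (F.sub n).mapQ (G.sub n) f (h.le_comap n) (x.1 n), fun m n hmn => by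
    obtain ⟨a, ha⟩ := (F.sub n).mkQ_surjective (x.1 n)
    have hx := x.2 m n hmn
    rw [← ha] at hx
    change Submodule.factor (G.antitone hmn)
        ((F.sub n).mapQ (G.sub n) f (h.le_comap n) (x.1 n)) =
      (F.sub m).mapQ (G.sub m) f (h.le_comap m) (x.1 m)
    rw [← ha, ← hx]
    rfl⟩
  map_add' x y := by
    ext n
    simp
  map_smul' c x := by
    ext n
    simp
  cont := by
    let _ : ∀ n, TopologicalSpace (A ⧸ F.sub n) := fun _ => ⊥
    let _ : ∀ n, TopologicalSpace (B ⧸ G.sub n) := fun _ => ⊥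
    have _ : ∀ n, DiscreteTopology (A ⧸ F.sub n) := fun _ => ⟨rfl⟩
    refine continuous_induced_rng.2 (continuous_pi fun n => ?_)
    exact (continuous_of_discreteTopology
      (f := (F.sub n).mapQ (G.sub n) f (h.le_comap n))).comp
      ((continuous_apply n).comp continuous_induced_dom)

theorem HasShift.map_toCompletion {F : AlgFiltration k A} {G : AlgFiltration k B} {d : ℕ}
    {f : A →ₗ[k] B} (h : HasShift F G d f) (a : A) :
    h.map (F.toCompletion a) = G.toCompletion (f a) := rfl

/-- The filtration induced on the source of an algebra morphism (used for inclusions). -/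
def comap (F : AlgFiltration k B) (f : A →ₙₐ[k] B) : AlgFiltration k A where
  sub n := (F.sub n).comap (toLin f)
  sub_zero := by rw [F.sub_zero]; rfl
  antitone _ _ h := Submodule.comap_mono (F.antitone h)
  mul_mem m n a b ha hb := by
    have h := F.mul_mem m n (f a) (f b) ha hb
    rw [← map_mul] at h
    exact h

end

/-- The filtration of a matrix algebra over a filtered algebra. -/
def matrix {k A : Type*} [CommRing k] [Ring A] [Algebra k A] (F : AlgFiltration k A) (d : ℕ) :
    AlgFiltration k (Matrix (Fin d) (Fin d) A) where
  sub n :=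
    { carrier := {M | ∀ i j, M i j ∈ F.sub n}
      add_mem' := fun hM hN i j => (F.sub n).add_mem (hM i j) (hN i j)
      zero_mem' := fun _ _ => (F.sub n).zero_mem
      smul_mem' := fun c _ hM i j => (F.sub n).smul_mem c (hM i j) }
  sub_zero := by
    refine eq_top_iff.2 fun M _ i j => ?_
    rw [F.sub_zero]
    trivial
  antitone _ _ h _ hM i j := F.antitone h (hM i j)
  mul_mem m n M N hM hN i j := by
    rw [Matrix.mul_apply]
    exact Submodule.sum_mem _ fun l _ => F.mul_mem m n _ _ (hM i l) (hN l j)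

/-- The tensor product filtration: `F n (A ⊗ B) = ∑_{i + j = n} F i A ⊗ F j B`. -/
def tensor {k A B : Type*} [CommRing k] [Ring A] [Algebra k A] [Ring B] [Algebra k B]
    (F : AlgFiltration k A) (G : AlgFiltration k B) : AlgFiltration k (A ⊗[k] B) where
  sub n := Submodule.span k
    {t | ∃ i j a b, i + j = n ∧ a ∈ F.sub i ∧ b ∈ G.sub j ∧ t = a ⊗ₜ[k] b}
  sub_zero := by
    refine eq_top_iff.2 ?_
    rw [← TensorProduct.span_tmul_eq_top]
    refine Submodule.span_mono ?_
    rintro _ ⟨a, b, rfl⟩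
    exact ⟨0, 0, a, b, rfl, by rw [F.sub_zero]; trivial, by rw [G.sub_zero]; trivial, rfl⟩
  antitone := by
    refine antitone_nat_of_succ_le fun n => Submodule.span_mono ?_
    rintro _ ⟨i, j, a, b, hij, ha, hb, rfl⟩
    rcases i with _ | i
    · exact ⟨0, n, a, b, by omega, ha, G.antitone (by omega) hb, rfl⟩
    · exact ⟨i, j, a, b, by omega, F.antitone (by omega) ha, hb, rfl⟩
  mul_mem m n x y hx hy := by
    induction hx using Submodule.span_induction with
    | mem x hx =>
      obtain ⟨i, j, a, b, hij, ha, hb, rfl⟩ := hx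
      induction hy using Submodule.span_induction with
      | mem y hy =>
        obtain ⟨p, q, c, d, hpq, hc, hd, rfl⟩ := hy
        refine Submodule.subset_span ⟨i + p, j + q, a * c, b * d, by omega,
          F.mul_mem _ _ _ _ ha hc, G.mul_mem _ _ _ _ hb hd, ?_⟩
        rw [Algebra.TensorProduct.tmul_mul_tmul]
      | zero => rw [mul_zero]; exact Submodule.zero_mem _
      | add y z _ _ hy hz => rw [mul_add]; exact Submodule.add_mem _ hy hz
      | smul c y _ hy => rw [mul_smul_comm]; exact Submodule.smul_mem _ c hy
    | zero => rw [zero_mul]; exact Submodule.zero_mem _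
    | add x z _ _ hx hz => rw [add_mul]; exact Submodule.add_mem _ hx hz
    | smul c x _ hx => rw [smul_mul_assoc]; exact Submodule.smul_mem _ c hx

/-- The adic filtration of the augmentation ideal, the kernel of the counit. -/
def augmentation (k A : Type*) [CommRing k] [Ring A] [Bialgebra k A] : AlgFiltration k A where
  sub n := ((RingHom.ker (Bialgebra.counitAlgHom k A)) ^ n).restrictScalars k
  sub_zero := by
    rw [Submodule.pow_zero, Ideal.one_eq_top]
    rfl
  antitone _ _ h := fun _ hx => Ideal.pow_le_pow_right h hx
  mul_mem m n a b ha hb := by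
    change a * b ∈ (RingHom.ker (Bialgebra.counitAlgHom k A)) ^ (m + n)
    rw [Ideal.IsTwoSided.pow_add]
    exact Ideal.mul_mem_mul ha hb

end AlgFiltration

/-! ### The product `r ·_e s = r e s`, and the subalgebras generated by `A e` and `e A` -/

/-- The module `A` with the product `r ·_e s = r e s`. -/
def Twisted {A : Type*} (_e : A) : Type _ := A

section

variable {A : Type*} [Ring A]

instance (e : A) : AddCommGroup (Twisted e) := inferInstanceAs (AddCommGroup A)

instance (k : Type*) [CommRing k] [Algebra k A] (e : A) : Module k (Twisted e) :=
  inferInstanceAs (Module k A)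

/-- The element of `A` underlying an element of `Twisted e`. -/
def Twisted.val {e : A} (r : Twisted e) : A := r

/-- The identity map from `A` to `A` with the product `·_e`, a linear isomorphism. -/
def toTwisted (k : Type*) [CommRing k] [Algebra k A] (e : A) : A ≃ₗ[k] Twisted e :=
  LinearEquiv.refl k A

/-- The product of `Twisted e`. -/
def twistedMul (e r s : A) : A := r * e * s

theorem twistedMul_add (e r s t : A) :
    twistedMul e r (s + t) = twistedMul e r s + twistedMul e r t := mul_add _ _ _

theorem add_twistedMul (e r s t : A) :
    twistedMul e (r + s) t = twistedMul e r t + twistedMul e s t := by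
  simp only [twistedMul, add_mul]

theorem zero_twistedMul (e s : A) : twistedMul e 0 s = 0 := by
  simp only [twistedMul, zero_mul]

theorem twistedMul_zero (e r : A) : twistedMul e r 0 = 0 := by
  simp only [twistedMul, mul_zero]

theorem twistedMul_assoc (e r s t : A) :
    twistedMul e (twistedMul e r s) t = twistedMul e r (twistedMul e s t) := by
  simp only [twistedMul, mul_assoc]

instance (e : A) : Mul (Twisted e) where
  mul r s := (twistedMul (A := A) e r.val s.val : A)

instance (e : A) : NonUnitalRing (Twisted e) where
  left_distrib := twistedMul_add e
  right_distrib := add_twistedMul e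
  zero_mul := zero_twistedMul e
  mul_zero := twistedMul_zero e
  mul_assoc := twistedMul_assoc e

theorem smul_twistedMul (k : Type*) [CommRing k] [Algebra k A] (e : A) (c : k) (r s : A) :
    twistedMul e (c • r) s = c • twistedMul e r s := by
  simp only [twistedMul, smul_mul_assoc]

theorem twistedMul_smul (k : Type*) [CommRing k] [Algebra k A] (e : A) (c : k) (r s : A) :
    c • twistedMul e r s = twistedMul e r (c • s) := by
  simp only [twistedMul, mul_smul_comm]

instance (k : Type*) [CommRing k] [Algebra k A] (e : A) :
    IsScalarTower k (Twisted e) (Twisted e) where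
  smul_assoc := smul_twistedMul k e

instance (k : Type*) [CommRing k] [Algebra k A] (e : A) :
    SMulCommClass k (Twisted e) (Twisted e) where
  smul_comm := twistedMul_smul k e

/-- The left ideal `A e`, as a non-unital subalgebra. -/
def mulRightRange (k : Type*) [CommRing k] [Algebra k A] (e : A) : NonUnitalSubalgebra k A where
  carrier := {w | ∃ a, w = a * e}
  add_mem' := by
    rintro _ _ ⟨a, rfl⟩ ⟨b, rfl⟩
    exact ⟨a + b, (add_mul _ _ _).symm⟩
  zero_mem' := ⟨0, (zero_mul _).symm⟩
  mul_mem' := by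
    rintro _ _ ⟨a, rfl⟩ ⟨b, rfl⟩
    exact ⟨a * e * b, (mul_assoc _ _ _).symm⟩
  smul_mem' := by
    rintro c _ ⟨a, rfl⟩
    exact ⟨c • a, (smul_mul_assoc _ _ _).symm⟩

/-- The morphism `(A, ·_e) → A e`, `r ↦ r e`. -/
def morLeft (k : Type*) [CommRing k] [Algebra k A] (e : A) :
    Twisted e →ₙₐ[k] mulRightRange k e where
  toFun r := ⟨r.val * e, ⟨r.val, rfl⟩⟩
  map_smul' c r := Subtype.ext (smul_mul_assoc c r.val e)
  map_zero' := Subtype.ext (zero_mul e)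
  map_add' r s := Subtype.ext (add_mul r.val s.val e)
  map_mul' r s := Subtype.ext (mul_assoc (r.val * e) s.val e)

/-- The subalgebra `k 1 + A e`. -/
def leftSub (k : Type*) [CommRing k] [Algebra k A] (e : A) : Subalgebra k A where
  carrier := {w | ∃ (c : k) (a : A), w = algebraMap k A c + a * e}
  add_mem' := by
    rintro _ _ ⟨c, a, rfl⟩ ⟨d, b, rfl⟩
    exact ⟨c + d, a + b, by rw [map_add, add_mul]; abel⟩
  mul_mem' := by
    rintro _ _ ⟨c, a, rfl⟩ ⟨d, b, rfl⟩
    refine ⟨c * d, algebraMap k A c * b + a * algebraMap k A d + a * e * b, ?_⟩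
    have h : e * algebraMap k A d = algebraMap k A d * e := (Algebra.commutes d e).symm
    simp only [map_mul, add_mul, mul_add, mul_assoc, h]
    abel
  algebraMap_mem' c := ⟨c, 0, by rw [zero_mul, add_zero]⟩

/-- The subalgebra `k 1 + e A`. -/
def rightSub (k : Type*) [CommRing k] [Algebra k A] (e : A) : Subalgebra k A where
  carrier := {w | ∃ (c : k) (a : A), w = algebraMap k A c + e * a}
  add_mem' := by
    rintro _ _ ⟨c, a, rfl⟩ ⟨d, b, rfl⟩
    exact ⟨c + d, a + b, by rw [map_add, mul_add]; abel⟩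
  mul_mem' := by
    rintro _ _ ⟨c, a, rfl⟩ ⟨d, b, rfl⟩
    refine ⟨c * d, algebraMap k A c * b + a * algebraMap k A d + a * e * b, ?_⟩
    have h : ∀ x, e * (algebraMap k A c * x) = algebraMap k A c * (e * x) := fun x => by
      rw [← mul_assoc, ← Algebra.commutes c e, mul_assoc]
    simp only [map_mul, add_mul, mul_add, mul_assoc, h]
    abel
  algebraMap_mem' c := ⟨c, 0, by rw [mul_zero, add_zero]⟩

/-- The inclusion of `A e` in `k 1 + A e`. -/
def leftIncl (k : Type*) [CommRing k] [Algebra k A] (e : A) :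
    mulRightRange k e →ₙₐ[k] leftSub k e where
  toFun w := ⟨w.1, by
    obtain ⟨a, ha⟩ := w.2
    exact ⟨0, a, by rw [map_zero, zero_add, ha]⟩⟩
  map_smul' _ _ := rfl
  map_zero' := rfl
  map_add' _ _ := rfl
  map_mul' _ _ := rfl

theorem exists_adLeft (k : Type*) [CommRing k] [Algebra k A] (e : A) (w : leftSub k e) :
    ∃ v : rightSub k e, (v : A) * e = e * (w : A) := by
  obtain ⟨w, c, a, rfl⟩ := w
  refine ⟨⟨algebraMap k A c + e * a, c, a, rfl⟩, ?_⟩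
  simp only [add_mul, mul_add, mul_assoc, Algebra.commutes]

/-- The algebra morphism `Ad(e) : k 1 + A e → k 1 + e A` given by `1 ↦ 1` and `a e ↦ e a`,
when right multiplication by `e` is injective. -/
def adLeft (k : Type*) [CommRing k] [Algebra k A] (e : A) (he : IsRightRegular e) :
    leftSub k e →ₐ[k] rightSub k e :=
  AlgHom.ofLinearMap
    { toFun := fun w => (exists_adLeft k e w).choose
      map_add' := fun v w => by
        apply Subtype.ext
        apply he
        have h1 := (exists_adLeft k e v).choose_spec
        have h2 := (exists_adLeft k e w).choose_spec
        have h3 := (exists_adLeft k e (v + w)).choose_spec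
        simp only [Subalgebra.coe_add, add_mul, mul_add] at h1 h2 h3 ⊢
        rw [h1, h2, h3]
      map_smul' := fun c w => by
        apply Subtype.ext
        apply he
        have h2 := (exists_adLeft k e w).choose_spec
        have h3 := (exists_adLeft k e (c • w)).choose_spec
        simp only [Subalgebra.coe_smul, smul_mul_assoc, mul_smul_comm, RingHom.id_apply]
          at h2 h3 ⊢
        rw [h2, h3] }
    (by
      apply Subtype.ext
      apply he
      have h3 := (exists_adLeft k e 1).choose_spec
      simpa using h3)
    (fun v w => by
      apply Subtype.ext
      apply he
      have h1 := (exists_adLeft k e v).choose_spec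
      have h2 := (exists_adLeft k e w).choose_spec
      have h3 := (exists_adLeft k e (v * w)).choose_spec
      simp only [LinearMap.coe_mk, AddHom.coe_mk, Subalgebra.coe_mul] at h1 h2 h3 ⊢
      rw [h3, mul_assoc, h2, ← mul_assoc, ← mul_assoc, h1])

/-- The defining formula `Ad(e)(c + a e) = c + e a`. -/
theorem adLeft_apply (k : Type*) [CommRing k] [Algebra k A] (e : A) (he : IsRightRegular e)
    (c : k) (a : A) (h : algebraMap k A c + a * e ∈ leftSub k e) :
    (adLeft k e he ⟨algebraMap k A c + a * e, h⟩ : A) = algebraMap k A c + e * a := by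
  apply he
  refine ((exists_adLeft k e ⟨algebraMap k A c + a * e, h⟩).choose_spec).trans ?_
  simp only [add_mul, mul_add, mul_assoc, Algebra.commutes]

/-- Conjugation `x ↦ u x u⁻¹` by a unit. -/
def conj (k : Type*) [CommRing k] [Algebra k A] (u : Aˣ) : A →ₐ[k] A where
  toFun x := u * x * (u⁻¹ : Aˣ)
  map_one' := by simp
  map_mul' x y := by simp [mul_assoc]
  map_zero' := by simp
  map_add' x y := by rw [mul_add, add_mul]
  commutes' c := by rw [← Algebra.commutes, mul_assoc, Units.mul_inv, mul_one]

/-- Let `J` be a two-sided ideal of `R`, free as a left `R`-module with basis `(b i)`. This is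
the algebra morphism `R → M_d(R)`, `r ↦ (m i j)`, where `b i * r = ∑ j, m i j * b j`. -/
def basisMatrix {k R : Type*} [CommRing k] [Ring R] [Algebra k R] {d : ℕ} (J : Ideal R)
    [J.IsTwoSided] (b : Module.Basis (Fin d) R J) : R →ₐ[k] Matrix (Fin d) (Fin d) R :=
  AlgHom.ofLinearMap
    { toFun := fun r => Matrix.of fun i j =>
        b.repr ⟨(b i : R) * r, J.mul_mem_right r (b i).2⟩ j
      map_add' := fun r s => by
        ext i j
        have h : (⟨(b i : R) * (r + s), J.mul_mem_right _ (b i).2⟩ : J) =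
            ⟨(b i : R) * r, J.mul_mem_right _ (b i).2⟩ +
              ⟨(b i : R) * s, J.mul_mem_right _ (b i).2⟩ := Subtype.ext (mul_add _ _ _)
        exact (congrArg (fun x => b.repr x j) h).trans (by rw [map_add]; rfl)
      map_smul' := fun c r => by
        ext i j
        have h : (⟨(b i : R) * (c • r), J.mul_mem_right _ (b i).2⟩ : J) =
            (algebraMap k R c) • ⟨(b i : R) * r, J.mul_mem_right _ (b i).2⟩ :=
          Subtype.ext ((mul_smul_comm _ _ _).trans (Algebra.smul_def _ _))
        exact (congrArg (fun x => b.repr x j) h).trans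
          (by rw [map_smul]; exact (Algebra.smul_def _ _).symm) }
    (by
      ext i j
      simp [Matrix.one_apply, Finsupp.single_apply])
    (fun r s => by
      ext i j
      have h : (⟨(b i : R) * (r * s), J.mul_mem_right _ (b i).2⟩ : J) =
          ∑ l, (b.repr ⟨(b i : R) * r, J.mul_mem_right _ (b i).2⟩ l) •
            (⟨(b l : R) * s, J.mul_mem_right _ (b l).2⟩ : J) := by
        apply Subtype.ext
        have h1 := congrArg (fun x : J => (x : R) * s)
          (b.sum_repr ⟨(b i : R) * r, J.mul_mem_right _ (b i).2⟩)
        simp only [Submodule.coe_sum, Submodule.coe_smul, smul_eq_mul, Finset.sum_mul] at h1 ⊢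
        rw [← mul_assoc, ← h1]
        simp only [mul_assoc]
      refine (congrArg (fun x => b.repr x j) h).trans ?_
      rw [map_sum, Finsupp.finsetSum_apply]
      refine Finset.sum_congr rfl fun l _ => ?_
      rw [map_smul]
      rfl)

end

/-! ### The groups `F₂` and `P₅^*` -/

/-- The free group on `X₀`, `X₁`. -/
abbrev F2 : Type := FreeGroup (Fin 2)

/-- The generator `X₀` of `F₂`. -/
def X0 : F2 := FreeGroup.of 0

/-- The generator `X₁` of `F₂`. -/
def X1 : F2 := FreeGroup.of 1

/-- The standard generators `x_{ij}`, `i < j ≤ 4`, of the pure Artin braid group `K₄`. -/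
inductive Gen : Type
  | x12 | x13 | x14 | x23 | x24 | x34

/-- The commutator `(a, b) = a b a⁻¹ b⁻¹`. -/
def comm {G : Type*} [Group G] (a b : G) : G := a * b * a⁻¹ * b⁻¹

/-- The relations making `a b c` commute with `a`, `b` and `c`. -/
def tripleRels {G : Type*} [Group G] (a b c : G) : Set G :=
  {comm (a * b * c) a, comm (a * b * c) b, comm (a * b * c) c}

open FreeGroup Gen in
/-- Artin's relations between the generators of the pure braid group `K₄`. -/
def braidRels : Set (FreeGroup Gen) :=
  tripleRels (of x12) (of x13) (of x23) ∪ tripleRels (of x12) (of x14) (of x24) ∪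
  tripleRels (of x13) (of x14) (of x34) ∪ tripleRels (of x23) (of x24) (of x34) ∪
  {comm (of x12) (of x34), comm (of x13) ((of x12)⁻¹ * of x24 * of x12),
    comm (of x14) (of x23)}

open FreeGroup Gen in
/-- The generator of the center of `K₄` (the full twist). -/
def fullTwist : FreeGroup Gen :=
  of x12 * (of x13 * of x23) * (of x14 * of x24 * of x34)

/-- The pure modular group `P₅^*` of the sphere with five marked points, that is, the quotient of
the pure Artin braid group `K₄` by its center. -/
abbrev P5 : Type := PresentedGroup (braidRels ∪ {fullTwist})

/-- The image in `P₅^*` of a generator of `K₄`. -/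
def gen (g : Gen) : P5 := PresentedGroup.of g

/-- The elements `x_{15}`, `x_{25}`, `x_{35}` of `P₅^*`. -/
def x5 : Fin 3 → P5 :=
  ![(gen .x12 * gen .x13 * gen .x14)⁻¹, (gen .x12 * gen .x23 * gen .x24)⁻¹,
    (gen .x13 * gen .x23 * gen .x34)⁻¹]

/-- The morphism `F₂ → P₅^*`, `X₀ ↦ x_{23}`, `X₁ ↦ x_{12}`. -/
def ellGrp : F2 →* P5 := FreeGroup.lift ![gen .x23, gen .x12]

/-- Images of the generators under `pr₁`. -/
def pr1Fun : Gen → F2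
  | .x12 => 1
  | .x13 => 1
  | .x14 => 1
  | .x23 => X0
  | .x24 => (X1 * X0)⁻¹
  | .x34 => X1

/-- Images of the generators under `pr₂`. -/
def pr2Fun : Gen → F2
  | .x12 => 1
  | .x13 => (X0 * X1)⁻¹
  | .x14 => X0
  | .x23 => 1
  | .x24 => 1
  | .x34 => X1

/-- Images of the generators under `pr₅`. -/
def pr5Fun : Gen → F2
  | .x12 => X1
  | .x13 => (X0 * X1)⁻¹
  | .x14 => X0
  | .x23 => X0
  | .x24 => (X1 * X0)⁻¹
  | .x34 => X1

theorem pr1_rels : ∀ r ∈ braidRels ∪ {fullTwist}, FreeGroup.lift pr1Fun r = 1 := by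
  rintro r hr
  simp only [braidRels, tripleRels, fullTwist, Set.mem_union, Set.mem_insert_iff,
    Set.mem_singleton_iff] at hr
  rcases hr with ((((((rfl | rfl | rfl) | (rfl | rfl | rfl)) | (rfl | rfl | rfl)) |
    (rfl | rfl | rfl)) | (rfl | rfl | rfl)) | rfl) <;>
    simp [pr1Fun, comm, mul_assoc]

theorem pr2_rels : ∀ r ∈ braidRels ∪ {fullTwist}, FreeGroup.lift pr2Fun r = 1 := by
  rintro r hr
  simp only [braidRels, tripleRels, fullTwist, Set.mem_union, Set.mem_insert_iff,
    Set.mem_singleton_iff] at hr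
  rcases hr with ((((((rfl | rfl | rfl) | (rfl | rfl | rfl)) | (rfl | rfl | rfl)) |
    (rfl | rfl | rfl)) | (rfl | rfl | rfl)) | rfl) <;>
    simp [pr2Fun, comm, mul_assoc]

theorem pr5_rels : ∀ r ∈ braidRels ∪ {fullTwist}, FreeGroup.lift pr5Fun r = 1 := by
  rintro r hr
  simp only [braidRels, tripleRels, fullTwist, Set.mem_union, Set.mem_insert_iff,
    Set.mem_singleton_iff] at hr
  rcases hr with ((((((rfl | rfl | rfl) | (rfl | rfl | rfl)) | (rfl | rfl | rfl)) |
    (rfl | rfl | rfl)) | (rfl | rfl | rfl)) | rfl) <;>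
    simp [pr5Fun, comm, mul_assoc]

/-- The morphism `pr₁ : P₅^* → F₂` (forgetting the first marked point). -/
def pr1 : P5 →* F2 := PresentedGroup.toGroup pr1_rels

/-- The morphism `pr₂ : P₅^* → F₂` (forgetting the second marked point). -/
def pr2 : P5 →* F2 := PresentedGroup.toGroup pr2_rels

/-- The morphism `pr₅ : P₅^* → F₂` (forgetting the fifth marked point). -/
def pr5 : P5 →* F2 := PresentedGroup.toGroup pr5_rels

/-! ### The constituents of the diagram -/

section

variable (k : Type*) [CommRing k]

/-- The group algebra `k F₂`. -/
abbrev KF : Type _ := MonoidAlgebra k F2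

/-- The group algebra `k P₅^*`. -/
abbrev KP : Type _ := MonoidAlgebra k P5

/-- `(k F₂)^{⊗ 2}`. -/
abbrev KFKF : Type _ := KF k ⊗[k] KF k

/-- The element of `k F₂` attached to an element of `F₂`. -/
def grp (g : F2) : KF k := MonoidAlgebra.of k F2 g

/-- The element `X₁ - 1` of `k F₂`. -/
def e1 : KF k := grp k X1 - 1

theorem isRightRegular_e1 : IsRightRegular (e1 k) := by
  intro a b hab
  have hc : (a - b) * grp k X1 = a - b := by
    have h : a * e1 k = b * e1 k := hab
    simp only [e1, mul_sub, mul_one] at h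
    rw [sub_mul, sub_eq_sub_iff_add_eq_add]
    rw [sub_eq_sub_iff_add_eq_add] at h
    rw [add_comm, add_comm a, ← h, add_comm]
  rw [← sub_eq_zero]
  generalize a - b = c at hc
  have hs : ∀ g, c.coeff (g * X1) = c.coeff g := fun g => by
    conv_lhs => rw [← hc]
    rw [grp, MonoidAlgebra.of_apply,
      MonoidAlgebra.coeff_mul_single_eq_coeff_mul g fun m' _ => mul_left_inj X1, mul_one]
  have hp : ∀ g, ∀ n : ℕ, c.coeff (g * X1 ^ n) = c.coeff g := fun g n => by
    induction n with
    | zero => rw [pow_zero, mul_one]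
    | succ n ih => rw [pow_succ, ← mul_assoc, hs, ih]
  have hX : (X1 : F2) ≠ 1 := FreeGroup.of_ne_one _
  have hinj : Function.Injective fun n : ℕ => (X1 : F2) ^ n := by
    intro m n hmn
    have h1 : (X1 : F2) ^ ((m : ℤ) - n) = 1 := by
      rw [zpow_sub, zpow_natCast, zpow_natCast, mul_inv_eq_one]
      exact hmn
    have h2 := (IsMulTorsionFree.zpow_eq_one_iff_right hX).1 h1
    omega
  ext g
  by_contra hg
  refine Set.infinite_of_injective_forall_mem (f := fun n : ℕ => g * X1 ^ n)
    (s := (c.coeff.support : Set F2)) (fun m n h => hinj (mul_left_cancel h)) (fun n => ?_)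
    (Finset.finite_toSet _)
  rw [Finset.mem_coe, Finsupp.mem_support_iff, hp]
  exact hg

/-- The algebra morphism `k F₂ → k P₅^*` induced by `X₀ ↦ x_{23}`, `X₁ ↦ x_{12}`. -/
def ell : KF k →ₐ[k] KP k := MonoidAlgebra.mapDomainAlgHom k k ellGrp

/-- The algebra morphism `k P₅^* → k F₂` induced by `pr₅`. -/
def pr5Alg : KP k →ₐ[k] KF k := MonoidAlgebra.mapDomainAlgHom k k pr5

/-- The ideal `Ker(pr₅)` of `k P₅^*`. -/
def J5 : Ideal (KP k) := RingHom.ker (pr5Alg k)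

instance : (J5 k).IsTwoSided := inferInstanceAs (RingHom.ker (pr5Alg k)).IsTwoSided

/-- The elements `x_{i5} - 1`, `i = 1, 2, 3`, of `k P₅^*`. -/
def x5Sub (i : Fin 3) : KP k := MonoidAlgebra.of k P5 (x5 i) - 1

/-- The algebra morphism `k P₅^* → (k F₂)^{⊗ 2}` given by `g ↦ pr₁ g ⊗ pr₂ g` on `P₅^*`. -/
def pr12 : KP k →ₐ[k] KFKF k :=
  MonoidAlgebra.lift k (KFKF k) P5
    { toFun := fun g => grp k (pr1 g) ⊗ₜ[k] grp k (pr2 g)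
      map_one' := by simp [grp, ← MonoidAlgebra.one_def, Algebra.TensorProduct.one_def]
      map_mul' := fun g h => by simp [grp] }

/-- The element `X₁ ⊗ 1`, denoted `X₁`. -/
def X1T : KFKF k := grp k X1 ⊗ₜ[k] 1

/-- The element `1 ⊗ X₁`, denoted `Y₁`. -/
def Y1T : KFKF k := 1 ⊗ₜ[k] grp k X1

/-- The row `(X₁ - 1, 1 - Y₁, 0)`. -/
def row : Matrix (Fin 1) (Fin 3) (KFKF k) := !![X1T k - 1, 1 - Y1T k, 0]

/-- The column `(Y₁, -1, 0)`. -/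
def col : Matrix (Fin 3) (Fin 1) (KFKF k) := !![Y1T k; -1; 0]

/-- The linear map `M ↦ row · M · col`. -/
def rowCol : Matrix (Fin 3) (Fin 3) (KFKF k) →ₗ[k] KFKF k where
  toFun M := (row k * M * col k) 0 0
  map_add' M N := by rw [Matrix.mul_add, Matrix.add_mul]; rfl
  map_smul' c M := by rw [Matrix.mul_smul, Matrix.smul_mul]; rfl

/-- `W_l = k 1 + k F₂ (X₁ - 1)`. -/
abbrev Wl : Subalgebra k (KF k) := leftSub k (e1 k)

/-- `W_r = k 1 + (X₁ - 1) k F₂`. -/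
abbrev Wr : Subalgebra k (KF k) := rightSub k (e1 k)

/-- `(W_l)_+ = k F₂ (X₁ - 1)`. -/
abbrev WlPlus : NonUnitalSubalgebra k (KF k) := mulRightRange k (e1 k)

theorem unit_sub_one_mem (s : ℤˣ) :
    (∃ a, grp k (X1 ^ (s : ℤ)) - 1 = a * e1 k) ∧ ∃ a, grp k (X1 ^ (s : ℤ)) - 1 = e1 k * a := by
  rcases Int.units_eq_one_or s with rfl | rfl
  · exact ⟨⟨1, by simp [e1]⟩, ⟨1, by simp [e1]⟩⟩
  · refine ⟨⟨-grp k X1⁻¹, ?_⟩, ⟨-grp k X1⁻¹, ?_⟩⟩ <;>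
      simp [e1, grp, mul_sub, sub_mul, MonoidAlgebra.one_def, neg_add_eq_sub]

/-- `X₁^s`, `s = ±1`, as an element of `W_l`. -/
def X1l (s : ℤˣ) : Wl k := ⟨grp k (X1 ^ (s : ℤ)), by
  obtain ⟨a, ha⟩ := (unit_sub_one_mem k s).1
  exact ⟨1, a, by rw [← ha, map_one]; abel⟩⟩

/-- `X₁^s`, `s = ±1`, as an element of `W_r`. -/
def X1r (s : ℤˣ) : Wr k := ⟨grp k (X1 ^ (s : ℤ)), by
  obtain ⟨a, ha⟩ := (unit_sub_one_mem k s).2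
  exact ⟨1, a, by rw [← ha, map_one]; abel⟩⟩

/-- For `s = ±1` and `n ≥ 1`, the element `Y_n^s = (X₀^s - 1)^{n-1} X₀^s (1 - X₁^s)` of `W_l`. -/
def Yl (s : ℤˣ) (n : ℕ) : Wl k :=
  ⟨(grp k (X0 ^ (s : ℤ)) - 1) ^ (n - 1) * grp k (X0 ^ (s : ℤ)) * (1 - grp k (X1 ^ (s : ℤ))), by
    obtain ⟨a, ha⟩ := (unit_sub_one_mem k s).1
    refine ⟨0, (grp k (X0 ^ (s : ℤ)) - 1) ^ (n - 1) * grp k (X0 ^ (s : ℤ)) * (-a), ?_⟩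
    rw [map_zero, zero_add, mul_assoc _ (-a), neg_mul, ← ha, neg_sub]⟩

/-- The conditions defining the algebra morphism `Δ_♯ : W_l → W_l ⊗ W_l`. -/
def IsDeltaSharp (Δ : Wl k →ₐ[k] Wl k ⊗[k] Wl k) : Prop :=
  ∀ s : ℤˣ, Δ (X1l k s) = X1l k s ⊗ₜ[k] X1l k s ∧
    ∀ n : ℕ, 1 ≤ n → Δ (Yl k s n) = Yl k s n ⊗ₜ[k] 1 + 1 ⊗ₜ[k] Yl k s n +
      ∑ i ∈ Finset.Ico 1 n, Yl k s i ⊗ₜ[k] Yl k s (n - i)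

/-- `Δ^{l,r} = Ad(X₁ - 1)^{⊗ 2} ∘ Δ`. -/
def deltaLR (Δ : Wl k →ₐ[k] Wl k ⊗[k] Wl k) : Wl k →ₐ[k] Wr k ⊗[k] Wr k :=
  (Algebra.TensorProduct.map (adLeft k (e1 k) (isRightRegular_e1 k))
    (adLeft k (e1 k) (isRightRegular_e1 k))).comp Δ

/-- The invertible element `Y₁ = 1 ⊗ X₁` of `W_r ⊗ W_r`. -/
def Y1r : (Wr k ⊗[k] Wr k)ˣ where
  val := 1 ⊗ₜ[k] X1r k 1
  inv := 1 ⊗ₜ[k] X1r k (-1)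
  val_inv := by
    have h : X1r k 1 * X1r k (-1) = 1 := Subtype.ext (by simp [X1r, grp, MonoidAlgebra.one_def])
    rw [Algebra.TensorProduct.tmul_mul_tmul, h, one_mul, Algebra.TensorProduct.one_def]
  inv_val := by
    have h : X1r k (-1) * X1r k 1 = 1 := Subtype.ext (by simp [X1r, grp, MonoidAlgebra.one_def])
    rw [Algebra.TensorProduct.tmul_mul_tmul, h, one_mul, Algebra.TensorProduct.one_def]

/-- The bottom arrow `Ad(Y₁⁻¹) ∘ Δ^{l,r} : (W_l)_+ → W_r ⊗ W_r`. -/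
def bottom (Δ : Wl k →ₐ[k] Wl k ⊗[k] Wl k) : WlPlus k →ₙₐ[k] Wr k ⊗[k] Wr k :=
  (((conj (A := Wr k ⊗[k] Wr k) k (Y1r k)⁻¹).comp (deltaLR k Δ) : Wl k →ₐ[k] Wr k ⊗[k] Wr k) :
    Wl k →ₙₐ[k] Wr k ⊗[k] Wr k).comp (leftIncl k (e1 k))

/-- The inclusion `W_r ⊗ W_r → (k F₂)^{⊗ 2}`. -/
def inclRight : Wr k ⊗[k] Wr k →ₐ[k] KFKF k :=
  Algebra.TensorProduct.map (Wr k).val (Wr k).val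

/-- The linear isomorphism `k F₂ ≃ (k F₂, ·_{X₁ - 1})`. -/
def twist : KF k ≃ₗ[k] Twisted (e1 k) := toTwisted k (e1 k)

/-- The morphism `(k F₂, ·_{X₁ - 1}) → (W_l)_+`, `r ↦ r (X₁ - 1)`. -/
def mor : Twisted (e1 k) →ₙₐ[k] WlPlus k := morLeft k (e1 k)

/-- The entrywise extension of `pr₁₂` to `3 × 3` matrices. -/
def pr12Mat : Matrix (Fin 3) (Fin 3) (KP k) →ₐ[k] Matrix (Fin 3) (Fin 3) (KFKF k) :=
  (pr12 k).mapMatrix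

/-- The morphism `ϖ : k P₅^* → M₃(k P₅^*)` attached to a basis of `Ker(pr₅)`. -/
def varpi (b : Module.Basis (Fin 3) (KP k) (J5 k)) :
    KP k →ₐ[k] Matrix (Fin 3) (Fin 3) (KP k) :=
  basisMatrix (J5 k) b

/-! ### Filtrations -/

/-- `k F₂`, with the powers of its augmentation ideal. -/
def filKF : AlgFiltration k (KF k) := AlgFiltration.augmentation k (KF k)

theorem e1_mem_filKF : e1 k ∈ (filKF k).sub 1 := by
  change e1 k ∈ (RingHom.ker (Bialgebra.counitAlgHom k (KF k))) ^ 1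
  rw [Submodule.pow_one, RingHom.mem_ker]
  simp [e1, grp]

/-- `k P₅^*`, with the powers of its augmentation ideal. -/
def filKP : AlgFiltration k (KP k) := AlgFiltration.augmentation k (KP k)

/-- `(k F₂)^{⊗ 2}`, the group algebra of `F₂ × F₂`, with the powers of its augmentation ideal. -/
def filKFKF : AlgFiltration k (KFKF k) := AlgFiltration.augmentation k (KFKF k)

/-- `W_r`, with the filtration induced by that of `k F₂`. -/
def filWr : AlgFiltration k (Wr k) := (filKF k).comap ((Wr k).val : Wr k →ₙₐ[k] KF k)

/-- `(W_l)_+`, with the filtration induced by that of `k F₂`. -/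
def filWlPlus : AlgFiltration k (WlPlus k) :=
  (filKF k).comap (NonUnitalSubalgebraClass.subtype (WlPlus k))

/-- `(k F₂, ·_{X₁ - 1})`, with `F 0 = k F₂` and `F n = I^{n-1}` for `n ≥ 1`. -/
def filTwisted : AlgFiltration k (Twisted (e1 k)) where
  sub n := ((filKF k).sub (n - 1)).map (twist k : KF k →ₗ[k] Twisted (e1 k))
  sub_zero := by
    rw [(filKF k).sub_zero]
    exact LinearMap.range_eq_top.2 (twist k).surjective |> fun h => by rw [Submodule.map_top, h]
  antitone m n h := Submodule.map_mono ((filKF k).antitone (by omega))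
  mul_mem m n a b ha hb := by
    obtain ⟨a, ha, rfl⟩ := ha
    obtain ⟨b, hb, rfl⟩ := hb
    refine ⟨a * e1 k * b, (filKF k).antitone ?_
      ((filKF k).mul_mem _ _ _ _ ((filKF k).mul_mem _ _ _ _ ha (e1_mem_filKF k)) hb), rfl⟩
    omega

end

end BettiBraid

end

open BettiBraid

noncomputable section

namespace BettiBraid

/-! ### The kernel of `pr₅` -/

/-! The group `P₅^*` is a semidirect product `F₃ ⋊ F₂`: the `x_{i5}` generate freely the kernel of
`pr₅`, and `ellGrp` splits `pr₅`. The relations give the conjugation action of `x₁₂` and `x₂₃` on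
the `x_{i5}`. Fox derivatives on `F₃`, transported along the cosets of the kernel, then show that
the `x_{i5} - 1` form a basis of `J`, and the conjugation formulas give the matrices of `ϖ`
explicitly.

Let `ρ` be the composite of the top row before the last arrow. The decisive fact is the rank one
factorization `ρ(X₁ - 1) = col · row` (`rho_e1`). It makes `f ↦ row · ρ(f) · col` multiplicative for
the product `f (X₁ - 1) g` (`topRow_mul`), so this map yields an algebra morphism `Φ` on `W_l = k ⊕
k F₂ (X₁ - 1)` (`exists_leftSub_lift`).

On the other side, `psi = incl ∘ Ad(Y₁⁻¹) ∘ Ad(X₁ - 1)^{⊗ 2}` is injective. In suitable coordinates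
`ρ(X₀)` is triangular, so that `ρ((X₀^{±1} - 1)^{n-1} X₀^{±1}) · col` has a closed form
(`rho_powX0_one`, `rho_powX0_neg_one`). Consequently `Φ` takes each of `X₁^{±1}`, `Y_n^±` to the
image under `psi` of its prescribed coproduct. These elements generate `W_l`
(`eq_top_of_generators_mem`), hence `Φ` factors through `psi`. The factorization is the coproduct
(`exists_delta`): its existence and the commutativity of the diagram are obtained together, with no
need for a presentation of `W_l`, and uniqueness follows from generation.

For the filtrations, morphisms out of group algebras are controlled by augmentations. The bottom
arrow is handled through the diagram: division by `X₁ - 1` lowers the filtration by one, the top row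
raises it by one, and a filtered retraction of `k F₂` on `W_r` shows that `incl` is strict. The
completed statements follow on representatives. -/

theorem mk_rel_eq_one {r : FreeGroup Gen} (hr : r ∈ braidRels ∪ {fullTwist}) :
    FreeGroup.lift gen r = 1 := by
  have h : FreeGroup.lift gen = PresentedGroup.mk (braidRels ∪ {fullTwist}) := by
    ext g
    simp [gen, PresentedGroup.of]
  rw [h]
  exact PresentedGroup.one_of_mem hr

theorem commute_of_comm_eq_one {G : Type*} [Group G] {a b : G} (h : comm a b = 1) :
    Commute a b := by
  rw [comm, mul_inv_eq_one, mul_inv_eq_iff_eq_mul] at h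
  exact h

theorem map_comm {G H : Type*} [Group G] [Group H] (f : G →* H) (a b : G) :
    f (comm a b) = comm (f a) (f b) := by
  simp [comm]

theorem commute_gen {a b : FreeGroup Gen} (h : comm a b ∈ braidRels) :
    Commute (FreeGroup.lift gen a) (FreeGroup.lift gen b) :=
  commute_of_comm_eq_one (by rw [← map_comm]; exact mk_rel_eq_one (Or.inl h))

/-! ### Relations in `P₅^*` between `x₁₂`, `x₂₃` and the `x_{i5}` -/

theorem commute_x12_x34 : Commute (gen .x12) (gen .x34) := by
  simpa using commute_gen (a := .of .x12) (b := .of .x34) (by simp [braidRels])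

theorem commute_x14_x23 : Commute (gen .x14) (gen .x23) := by
  simpa using commute_gen (a := .of .x14) (b := .of .x23) (by simp [braidRels])

theorem commute_x123_x12 : Commute (gen .x12 * gen .x13 * gen .x23) (gen .x12) := by
  simpa using commute_gen (a := .of .x12 * .of .x13 * .of .x23) (b := .of .x12)
    (by simp [braidRels, tripleRels])

theorem commute_x234_x23 : Commute (gen .x23 * gen .x24 * gen .x34) (gen .x23) := by
  simpa using commute_gen (a := .of .x23 * .of .x24 * .of .x34) (b := .of .x23)
    (by simp [braidRels, tripleRels])

theorem commute_x234_x34 : Commute (gen .x23 * gen .x24 * gen .x34) (gen .x34) := by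
  simpa using commute_gen (a := .of .x23 * .of .x24 * .of .x34) (b := .of .x34)
    (by simp [braidRels, tripleRels])

theorem commute_x134_x14 : Commute (gen .x13 * gen .x14 * gen .x34) (gen .x14) := by
  simpa using commute_gen (a := .of .x13 * .of .x14 * .of .x34) (b := .of .x14)
    (by simp [braidRels, tripleRels])

theorem commute_x134_x34 : Commute (gen .x13 * gen .x14 * gen .x34) (gen .x34) := by
  simpa using commute_gen (a := .of .x13 * .of .x14 * .of .x34) (b := .of .x34)
    (by simp [braidRels, tripleRels])

theorem fullTwist_eq_one :
    gen .x12 * (gen .x13 * gen .x23) * (gen .x14 * gen .x24 * gen .x34) = 1 := by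
  simpa [fullTwist] using mk_rel_eq_one (r := fullTwist) (Or.inr rfl)

/-- Since `x₁₄` and `x₂₃` commute, the full twist can be rearranged as `(x₁₂ x₁₃ x₁₄)(x₂₃ x₂₄ x₃₄)`.
-/
theorem x15_eq : x5 0 = gen .x23 * gen .x24 * gen .x34 := by
  have h := fullTwist_eq_one
  have h1 := commute_x14_x23.eq
  change (gen .x12 * gen .x13 * gen .x14)⁻¹ = _
  rw [inv_eq_iff_mul_eq_one]
  calc _ = gen .x12 * gen .x13 * (gen .x14 * gen .x23) * gen .x24 * gen .x34 := by group
    _ = gen .x12 * (gen .x13 * gen .x23) * (gen .x14 * gen .x24 * gen .x34) := by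
      rw [h1]; group
    _ = 1 := h

theorem x34_eq : gen .x34 = x5 1 * gen .x12 * x5 0 := by
  rw [x15_eq]
  change _ = (gen .x12 * gen .x23 * gen .x24)⁻¹ * _ * _
  group

theorem commute_x12_x35 : Commute (gen .x12) (x5 2) := by
  have h : x5 2 = ((gen .x12)⁻¹ * (gen .x12 * gen .x13 * gen .x23) * gen .x34)⁻¹ := by
    change (gen .x13 * gen .x23 * gen .x34)⁻¹ = _
    group
  rw [h]
  exact ((((Commute.refl (gen .x12)).inv_right.mul_right commute_x123_x12.symm).mul_right
    commute_x12_x34)).inv_right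

theorem commute_x23_x15 : Commute (gen .x23) (x5 0) := by
  rw [x15_eq]; exact commute_x234_x23.symm

theorem commute_x34_x15 : Commute (gen .x34) (x5 0) := by
  rw [x15_eq]; exact commute_x234_x34.symm

theorem commute_x34_x25 : Commute (gen .x34) (x5 1) := by
  have h : x5 1 = gen .x34 * (x5 0)⁻¹ * (gen .x12)⁻¹ := by
    rw [x34_eq]; group
  rw [h]
  exact ((Commute.refl _).mul_right commute_x34_x15.inv_right).mul_right
    commute_x12_x34.symm.inv_right

theorem x15_mul_x25 : x5 0 * x5 1 * gen .x12 = gen .x34 := by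
  rw [← mul_left_inj (x5 0), commute_x34_x15.eq]
  conv_rhs => rw [x34_eq]
  group

theorem conj_of_commute {G : Type*} [Group G] {g z p n : G} (hg : g * p = z)
    (h : Commute z n) : g⁻¹ * n * g = p * n * p⁻¹ := by
  have hg' : g = z * p⁻¹ := eq_mul_inv_of_mul_eq hg
  rw [hg', mul_inv_rev, inv_inv, mul_assoc, ← mul_assoc n, ← h.eq]
  group

/-- Since `x₁₂ · x₁₅ x₂₅ = x₃₄`, conjugation by `x₁₂⁻¹` agrees with conjugation by `x₁₅ x₂₅` on
whatever commutes with `x₃₄`, in particular on `x₁₅` and `x₂₅`. -/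
theorem x12_conj (i : Fin 3) (hi : Commute (gen .x34) (x5 i)) :
    (gen .x12)⁻¹ * x5 i * gen .x12 = x5 0 * x5 1 * x5 i * (x5 0 * x5 1)⁻¹ := by
  refine conj_of_commute ?_ hi
  have h : gen .x12 = (x5 0 * x5 1)⁻¹ * gen .x34 := by rw [← x15_mul_x25]; group
  rw [h, mul_assoc, (commute_x34_x15.mul_right commute_x34_x25).eq, inv_mul_cancel_left]

theorem x14_eq : gen .x14 = gen .x23 * (x5 0 * x5 1 * x5 2 * (x5 0)⁻¹) := by
  have h1 : gen .x14 = gen .x23 * gen .x34 * (x5 2 * (gen .x12)⁻¹) * (x5 0)⁻¹ := by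
    change _ = _ * ((gen .x13 * gen .x23 * gen .x34)⁻¹ * _) *
      ((gen .x12 * gen .x13 * gen .x14)⁻¹)⁻¹
    group
  rw [h1, ← commute_x12_x35.inv_left.eq, ← x15_mul_x25]
  group

/-- The element `x₁₅ x₂₅ x₁₅⁻¹` is `x₁₃ x₁₄ x₃₄`, so this is one of the triple relations. -/
theorem commute_x14_conj : Commute (gen .x14) (x5 0 * x5 1 * (x5 0)⁻¹) := by
  have h : x5 0 * x5 1 * (x5 0)⁻¹ = gen .x13 * gen .x14 * gen .x34 := by
    have h1 : x5 0 * x5 1 = gen .x34 * (gen .x12)⁻¹ := by rw [← x15_mul_x25]; group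
    rw [h1, ← mul_left_inj (gen .x34), commute_x134_x34.eq]
    have h3 : (x5 0)⁻¹ = gen .x12 * gen .x13 * gen .x14 := inv_inv _
    rw [h3]
    group
  rw [h]
  exact commute_x134_x14.symm

theorem x14_conj_eq : (x5 0)⁻¹ * gen .x14 * x5 0 = gen .x23 * (x5 1 * x5 2) := by
  rw [x14_eq, ← mul_assoc, ← commute_x23_x15.inv_right.eq]
  group

/-- The product `x₂₃ x₂₅ x₃₅` is the conjugate of `x₁₄` by `x₁₅⁻¹`. It commutes with `x₂₅` by
conjugating the previous commutation, and with `x₂₃` because `x₁₄` and `x₁₅` do; hence also with the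
remaining factor `x₃₅`. -/
theorem commute_x23_x25x35 :
    Commute (gen .x23 * (x5 1 * x5 2)) (x5 1) ∧ Commute (gen .x23 * (x5 1 * x5 2)) (x5 2) := by
  have h1 : Commute (gen .x23 * (x5 1 * x5 2)) (x5 1) := by
    rw [← x14_conj_eq]
    have h := (Commute.conj_iff (x5 0)⁻¹).2 commute_x14_conj
    simpa [mul_assoc] using h
  have h2 : Commute (gen .x23 * (x5 1 * x5 2)) (gen .x23) := by
    rw [← x14_conj_eq]
    exact ((commute_x23_x15.inv_right.mul_right commute_x14_x23.symm).mul_right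
      commute_x23_x15).symm
  refine ⟨h1, ?_⟩
  have h3 := (h1.inv_right.mul_right h2.inv_right).mul_right (Commute.refl _)
  simpa [mul_assoc] using h3

theorem x23_conj (i : Fin 3) (hi : Commute (gen .x23 * (x5 1 * x5 2)) (x5 i)) :
    (gen .x23)⁻¹ * x5 i * gen .x23 = x5 1 * x5 2 * x5 i * (x5 1 * x5 2)⁻¹ :=
  conj_of_commute rfl hi

/-! ### The decomposition of `P₅^*` as `F₃ ⋊ F₂` -/

/-- The generators of `F₃`. -/
abbrev gen3 (i : Fin 3) : FreeGroup (Fin 3) := FreeGroup.of i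

/-- The automorphism of `F₃` given by conjugation by `x_{12}` on the `x_{i5}`. -/
def autX12 : MulAut (FreeGroup (Fin 3)) :=
  MonoidHom.toMulEquiv
    (FreeGroup.lift ![(gen3 0 * gen3 1)⁻¹ * gen3 0 * (gen3 0 * gen3 1),
      (gen3 0 * gen3 1)⁻¹ * gen3 1 * (gen3 0 * gen3 1), gen3 2])
    (FreeGroup.lift ![gen3 0 * gen3 1 * gen3 0 * (gen3 0 * gen3 1)⁻¹,
      gen3 0 * gen3 1 * gen3 1 * (gen3 0 * gen3 1)⁻¹, gen3 2])
    (by ext i; fin_cases i <;> simp [mul_assoc])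
    (by ext i; fin_cases i <;> simp [mul_assoc])

/-- The automorphism of `F₃` given by conjugation by `x_{23}` on the `x_{i5}`. -/
def autX23 : MulAut (FreeGroup (Fin 3)) :=
  MonoidHom.toMulEquiv
    (FreeGroup.lift ![gen3 0, (gen3 1 * gen3 2)⁻¹ * gen3 1 * (gen3 1 * gen3 2),
      (gen3 1 * gen3 2)⁻¹ * gen3 2 * (gen3 1 * gen3 2)])
    (FreeGroup.lift ![gen3 0, gen3 1 * gen3 2 * gen3 1 * (gen3 1 * gen3 2)⁻¹,
      gen3 1 * gen3 2 * gen3 2 * (gen3 1 * gen3 2)⁻¹])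
    (by ext i; fin_cases i <;> simp [mul_assoc])
    (by ext i; fin_cases i <;> simp [mul_assoc])

theorem autX12_of (i : Fin 3) : autX12 (gen3 i) = ![(gen3 0 * gen3 1)⁻¹ * gen3 0 * (gen3 0 * gen3 1),
    (gen3 0 * gen3 1)⁻¹ * gen3 1 * (gen3 0 * gen3 1), gen3 2] i :=
  FreeGroup.lift_apply_of

theorem autX12_symm_of (i : Fin 3) : autX12.symm (gen3 i) =
    ![gen3 0 * gen3 1 * gen3 0 * (gen3 0 * gen3 1)⁻¹,
      gen3 0 * gen3 1 * gen3 1 * (gen3 0 * gen3 1)⁻¹, gen3 2] i :=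
  FreeGroup.lift_apply_of

theorem autX23_of (i : Fin 3) : autX23 (gen3 i) = ![gen3 0,
    (gen3 1 * gen3 2)⁻¹ * gen3 1 * (gen3 1 * gen3 2), (gen3 1 * gen3 2)⁻¹ * gen3 2 * (gen3 1 * gen3 2)] i :=
  FreeGroup.lift_apply_of

theorem autX23_symm_of (i : Fin 3) : autX23.symm (gen3 i) =
    ![gen3 0, gen3 1 * gen3 2 * gen3 1 * (gen3 1 * gen3 2)⁻¹,
      gen3 1 * gen3 2 * gen3 2 * (gen3 1 * gen3 2)⁻¹] i :=
  FreeGroup.lift_apply_of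

/-- The action of `F₂` on `F₃` for which `P₅^*` is the semidirect product. -/
def actF3 : F2 →* MulAut (FreeGroup (Fin 3)) := FreeGroup.lift ![autX23, autX12]

theorem actF3_X0 : actF3 X0 = autX23 := FreeGroup.lift_apply_of

theorem actF3_X1 : actF3 X1 = autX12 := FreeGroup.lift_apply_of

/-- Images of the generators of `P₅^*` in `F₃ ⋊ F₂`. -/
def semiFun : Gen → FreeGroup (Fin 3) ⋊[actF3] F2
  | .x12 => ⟨1, X1⟩
  | .x13 => ⟨(gen3 2)⁻¹ * (gen3 1)⁻¹ * (gen3 0)⁻¹, (X0 * X1)⁻¹⟩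
  | .x14 => ⟨gen3 0 * gen3 1 * gen3 2 * (gen3 0)⁻¹, X0⟩
  | .x23 => ⟨1, X0⟩
  | .x24 => ⟨gen3 0 * gen3 1 * gen3 2 * (gen3 1)⁻¹ * (gen3 2)⁻¹ * (gen3 1)⁻¹ * (gen3 0)⁻¹, (X1 * X0)⁻¹⟩
  | .x34 => ⟨gen3 0 * gen3 1, X1⟩

theorem comm_eq_one_iff {G : Type*} [Group G] {a b : G} : comm a b = 1 ↔ a * b = b * a := by
  rw [comm, mul_inv_eq_one, mul_inv_eq_iff_eq_mul]

theorem semi_rels : ∀ r ∈ braidRels ∪ {fullTwist}, FreeGroup.lift semiFun r = 1 := by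
  rintro r hr
  simp only [braidRels, tripleRels, fullTwist, Set.mem_union, Set.mem_insert_iff,
    Set.mem_singleton_iff] at hr
  rcases hr with ((((((rfl | rfl | rfl) | (rfl | rfl | rfl)) | (rfl | rfl | rfl)) |
    (rfl | rfl | rfl)) | (rfl | rfl | rfl)) | rfl)
  -- Goal 16 is the full twist, the only relation that is not a commutator. The others are checked
  -- in the form `a b = b a`, where both sides reduce to the same word.
  on_goal 16 =>
    refine SemidirectProduct.ext ?_ ?_ <;>
      simp [semiFun, mul_assoc, actF3_X0, actF3_X1, autX12_symm_of, autX23_of, autX23_symm_of]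
  all_goals
    rw [map_comm, comm_eq_one_iff]
    refine SemidirectProduct.ext ?_ ?_ <;>
    simp only [semiFun, mul_assoc, actF3_X0, actF3_X1, autX12_of, autX12_symm_of, autX23_of,
        autX23_symm_of, FreeGroup.lift_apply_of, map_mul, map_inv, SemidirectProduct.mul_left,
        SemidirectProduct.mul_right, SemidirectProduct.inv_left, SemidirectProduct.inv_right,
        MulAut.mul_apply, MulAut.inv_apply, Matrix.cons_val_zero, Matrix.cons_val_one,
        Matrix.cons_val, mul_inv_rev, inv_inv,  inv_mul_cancel_left, mul_inv_cancel_left,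
        mul_inv_cancel, inv_mul_cancel, mul_one, one_mul, inv_one, map_one]

/-- The isomorphism from `P₅^*` to `F₃ ⋊ F₂`, as a morphism. -/
def semi : P5 →* FreeGroup (Fin 3) ⋊[actF3] F2 := PresentedGroup.toGroup semi_rels

theorem semi_gen (g : Gen) : semi (gen g) = semiFun g := PresentedGroup.toGroup.of semi_rels

theorem pr1_gen (g : Gen) : pr1 (gen g) = pr1Fun g := PresentedGroup.toGroup.of pr1_rels

theorem pr2_gen (g : Gen) : pr2 (gen g) = pr2Fun g := PresentedGroup.toGroup.of pr2_rels

theorem pr5_gen (g : Gen) : pr5 (gen g) = pr5Fun g := PresentedGroup.toGroup.of pr5_rels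

theorem ellGrp_X0 : ellGrp X0 = gen .x23 := FreeGroup.lift_apply_of

theorem ellGrp_X1 : ellGrp X1 = gen .x12 := FreeGroup.lift_apply_of

/-- The morphism from `F₃` to `P₅^*` with image the kernel of `pr₅`. -/
def iota : FreeGroup (Fin 3) →* P5 := FreeGroup.lift x5

theorem iota_of (i : Fin 3) : iota (gen3 i) = x5 i := FreeGroup.lift_apply_of

/-- The relations express conjugation by `x₁₂⁻¹`, which is why the inverse automorphism is treated
first; `iota_actF3` inverts the formula. -/
theorem iota_autX12_symm (w : FreeGroup (Fin 3)) :
    iota (autX12.symm w) = (gen .x12)⁻¹ * iota w * gen .x12 := by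
  have h : iota.comp autX12.symm.toMonoidHom = (MulAut.conj (gen .x12)⁻¹).toMonoidHom.comp iota := by
    ext i
    have h2 := commute_x12_x35.eq
    have h0 := x12_conj 0 commute_x34_x15
    have h1 := x12_conj 1 commute_x34_x25
    fin_cases i <;>
      simp [autX12_symm_of, iota_of, h0, h1, mul_assoc, ← h2] at *
  simpa using DFunLike.congr_fun h w

theorem iota_autX23_symm (w : FreeGroup (Fin 3)) :
    iota (autX23.symm w) = (gen .x23)⁻¹ * iota w * gen .x23 := by
  have h : iota.comp autX23.symm.toMonoidHom = (MulAut.conj (gen .x23)⁻¹).toMonoidHom.comp iota := by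
    ext i
    have h0 := commute_x23_x15.eq
    have h1 := x23_conj 1 commute_x23_x25x35.1
    have h2 := x23_conj 2 commute_x23_x25x35.2
    fin_cases i <;>
      simp [autX23_symm_of, iota_of, mul_assoc, ← h0] at *
    · exact h1.symm
    · exact h2.symm
  simpa using DFunLike.congr_fun h w

theorem iota_actF3 (g : F2) (w : FreeGroup (Fin 3)) :
    iota (actF3 g w) = ellGrp g * iota w * (ellGrp g)⁻¹ := by
  have key : ∀ (a : MulAut (FreeGroup (Fin 3))) (x : P5),
      (∀ w, iota (a.symm w) = x⁻¹ * iota w * x) → ∀ w, iota (a w) = x * iota w * x⁻¹ := by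
    intro a x h w
    have h1 := h (a w)
    rw [MulEquiv.symm_apply_apply] at h1
    rw [h1]
    group
  have hpos : ∀ (i : Fin 2) w, iota (actF3 (.of i) w) =
      ellGrp (.of i) * iota w * (ellGrp (.of i))⁻¹ := by
    intro i w
    fin_cases i
    · change iota (actF3 X0 w) = ellGrp X0 * _ * (ellGrp X0)⁻¹
      rw [actF3_X0, ellGrp_X0]
      exact key _ _ iota_autX23_symm w
    · change iota (actF3 X1 w) = ellGrp X1 * _ * (ellGrp X1)⁻¹
      rw [actF3_X1, ellGrp_X1]
      exact key _ _ iota_autX12_symm w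
  induction g using FreeGroup.induction_on generalizing w with
  | C1 => simp
  | of i => exact hpos i w
  | inv_of i _ =>
    have h := hpos i ((actF3 (.of i))⁻¹ w)
    rw [← MulAut.mul_apply, mul_inv_cancel, MulAut.one_apply] at h
    rw [h, map_inv, map_inv]
    group
  | mul x y hx hy =>
    rw [map_mul, MulAut.mul_apply, hx, hy, map_mul]
    group

/-- The morphism from `F₃ ⋊ F₂` to `P₅^*` inverse to `semi`. -/
def semiInv : FreeGroup (Fin 3) ⋊[actF3] F2 →* P5 :=
  SemidirectProduct.lift iota ellGrp fun g => by
    ext w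
    simpa using iota_actF3 g _

theorem x13_eq : gen .x13 = (x5 2)⁻¹ * (x5 1)⁻¹ * (x5 0)⁻¹ * (gen .x12)⁻¹ * (gen .x23)⁻¹ := by
  have h : (gen .x34)⁻¹ = (x5 0 * x5 1)⁻¹ * (gen .x12)⁻¹ := by
    have h1 := (commute_x34_x15.mul_right commute_x34_x25).eq
    rw [← mul_inv_rev, inv_inj, ← mul_right_inj (x5 0 * x5 1), ← h1, ← mul_assoc (x5 0 * x5 1),
      x15_mul_x25]
  have h2 : gen .x13 = (x5 2)⁻¹ * (gen .x34)⁻¹ * (gen .x23)⁻¹ := by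
    change _ = ((gen .x13 * gen .x23 * gen .x34)⁻¹)⁻¹ * _ * _
    group
  rw [h2, h]
  group

theorem x24_eq : gen .x24 = (gen .x23)⁻¹ * (gen .x12)⁻¹ * (x5 1)⁻¹ := by
  change _ = _ * ((gen .x12 * gen .x23 * gen .x24)⁻¹)⁻¹
  group

/-- A left inverse is enough: it shows that every element is a word in the `x_{i5}` times an element
of the image of `ellGrp`. Freeness comes separately from `semi_x5`. -/
theorem semiInv_semi (g : P5) : semiInv (semi g) = g := by
  have h : semiInv.comp semi = MonoidHom.id P5 := by
    refine PresentedGroup.ext fun x => ?_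
    change semiInv (semi (gen x)) = gen x
    rw [semi_gen]
    have hmk : ∀ n h, semiInv ⟨n, h⟩ = iota n * ellGrp h := fun _ _ => rfl
    cases x with
    | x12 => simp [semiFun, hmk, ellGrp_X1]
    | x13 => simp [semiFun, hmk, iota_of, ellGrp_X1, ellGrp_X0, x13_eq, mul_assoc]
    | x14 =>
      -- The formulas for `x₁₄` and `x₂₄` have their `F₂` factor on the left, so the pair is
      -- rewritten in that order.
      have h1 : semiFun .x14 = ⟨1, X0⟩ * ⟨gen3 0 * gen3 1 * gen3 2 * (gen3 0)⁻¹, 1⟩ := by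
        refine SemidirectProduct.ext ?_ ?_ <;>
          simp [semiFun, actF3_X0, autX23_of, mul_assoc]
      rw [h1, map_mul, hmk, hmk, x14_eq]
      simp [iota_of, ellGrp_X0, mul_assoc]
    | x23 => simp [semiFun, hmk, ellGrp_X0]
    | x24 =>
      have h1 : semiFun .x24 = ⟨1, (X1 * X0)⁻¹⟩ * ⟨(gen3 1)⁻¹, 1⟩ := by
        refine SemidirectProduct.ext ?_ ?_ <;>
          simp [semiFun, actF3_X0, actF3_X1, autX23_symm_of, autX12_symm_of, mul_assoc]
      rw [h1, map_mul, hmk, hmk, x24_eq]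
      simp [iota_of, ellGrp_X0, ellGrp_X1]
    | x34 => simp [semiFun, hmk, iota_of, ellGrp_X1, x15_mul_x25]
  exact DFunLike.congr_fun h g

theorem semi_right (g : P5) : (semi g).right = pr5 g := by
  have h : SemidirectProduct.rightHom.comp semi = pr5 := by
    refine PresentedGroup.ext fun x => ?_
    change (semi (gen x)).right = pr5 (gen x)
    rw [semi_gen, pr5_gen]
    cases x <;> rfl
  exact DFunLike.congr_fun h g

theorem eq_iota_mul_ellGrp (g : P5) : g = iota (semi g).left * ellGrp (pr5 g) := by
  conv_lhs => rw [← semiInv_semi g]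
  rw [← semi_right]
  rfl

theorem pr5_ellGrp (g : F2) : pr5 (ellGrp g) = g := by
  have h : pr5.comp ellGrp = MonoidHom.id F2 := by
    ext i
    fin_cases i
    · change pr5 (ellGrp X0) = X0
      rw [ellGrp_X0, pr5_gen]; rfl
    · change pr5 (ellGrp X1) = X1
      rw [ellGrp_X1, pr5_gen]; rfl
  exact DFunLike.congr_fun h g

/-- There is no relation among the `x_{i5}`: `semi` recovers the word in `F₃`, on which Fox
derivatives are defined. -/
theorem semi_x5 (i : Fin 3) : semi (x5 i) = SemidirectProduct.inl (gen3 i) := by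
  fin_cases i
  · change semi (gen .x12 * gen .x13 * gen .x14)⁻¹ = _
    simp only [map_inv, map_mul, semi_gen]
    refine SemidirectProduct.ext ?_ ?_ <;>
      simp [semiFun, actF3_X0, actF3_X1, autX12_of, autX23_symm_of, mul_assoc]
  · change semi (gen .x12 * gen .x23 * gen .x24)⁻¹ = _
    simp only [map_inv, map_mul, semi_gen]
    refine SemidirectProduct.ext ?_ ?_ <;>
      simp [semiFun, actF3_X0, actF3_X1, autX12_of, autX23_of, mul_assoc]
  · change semi (gen .x13 * gen .x23 * gen .x34)⁻¹ = _
    simp only [map_inv, map_mul, semi_gen]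
    refine SemidirectProduct.ext ?_ ?_ <;>
      simp [semiFun, actF3_X1, autX12_of, autX12_symm_of, mul_assoc]

theorem pr5_x5 (i : Fin 3) : pr5 (x5 i) = 1 := by
  rw [← semi_right, semi_x5]; rfl

section

/-! ### Crossed morphisms on free groups, and the freeness of `Ker(pr₅)` -/

/-- On a free group, a crossed morphism with prescribed values on the generators. -/
theorem exists_crossed {α R : Type*} [Ring R] (ρ σ : FreeGroup α →* R) (u : α → R) :
    ∃ d : FreeGroup α → R, (∀ g h, d (g * h) = ρ g * d h + d g * σ h) ∧
      ∀ j, d (.of j) = u j := by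
  have hρ : ∀ g, ρ g * ρ g⁻¹ = 1 := fun g => by rw [← map_mul, mul_inv_cancel, map_one]
  have hρ' : ∀ g, ρ g⁻¹ * ρ g = 1 := fun g => by rw [← map_mul, inv_mul_cancel, map_one]
  have hσ : ∀ g, σ g * σ g⁻¹ = 1 := fun g => by rw [← map_mul, mul_inv_cancel, map_one]
  have hσ' : ∀ g, σ g⁻¹ * σ g = 1 := fun g => by rw [← map_mul, inv_mul_cancel, map_one]
  -- The crossed rule is multiplicativity of the triangular matrix with diagonal `(ρ, σ)` and corner
  -- `d`, so the universal property of the free group produces `d` as the corner entry.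
  let f : α → (Matrix (Fin 2) (Fin 2) R)ˣ := fun j =>
    { val := !![ρ (.of j), u j; 0, σ (.of j)]
      inv := !![ρ (.of j)⁻¹, -(ρ (.of j)⁻¹ * u j * σ (.of j)⁻¹); 0, σ (.of j)⁻¹]
      val_inv := by
        ext a b
        fin_cases a <;> fin_cases b <;> simp [Matrix.mul_apply, ← mul_assoc, hρ, hσ]
      inv_val := by
        ext a b
        fin_cases a <;> fin_cases b <;> simp [Matrix.mul_apply, mul_assoc, hρ', hσ'] }
  let Φ := FreeGroup.lift f
  have key : ∀ g, (Φ g).val 0 0 = ρ g ∧ (Φ g).val 1 0 = 0 ∧ (Φ g).val 1 1 = σ g := by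
    intro g
    induction g using FreeGroup.induction_on with
    | C1 => simp
    | of j => simp [Φ, f]
    | inv_of j _ =>
      have h : (Φ (FreeGroup.of j)⁻¹).val = (f j).inv := by
        simp only [Φ, map_inv, FreeGroup.lift_apply_of]; rfl
      rw [h]
      simp [f]
    | mul x y hx hy =>
      obtain ⟨a, b, c⟩ := hx
      obtain ⟨a', b', c'⟩ := hy
      simp [Matrix.mul_apply, a, b, c, a', b', c']
  refine ⟨fun g => (Φ g).val 0 1, fun g h => ?_, fun j => by simp [Φ, f]⟩
  simp [Matrix.mul_apply, (key g).1, (key h).2.2]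

variable (k : Type*) [CommRing k]

theorem ell_of (g : F2) : ell k (.of k F2 g) = .of k P5 (ellGrp g) := by
  simp [ell]

theorem pr5Alg_of (g : P5) : pr5Alg k (.of k P5 g) = .of k F2 (pr5 g) := by
  simp [pr5Alg]

theorem x5Sub_mem (i : Fin 3) : x5Sub k i ∈ J5 k := by
  rw [J5, RingHom.mem_ker, x5Sub, map_sub, pr5Alg_of, pr5_x5, map_one, map_one, sub_self]

/-- The linear extension of a function on a group to its group algebra. -/
def linExt {G M : Type*} [AddCommMonoid M] [Module k M] (f : G → M) : MonoidAlgebra k G →ₗ[k] M :=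
  (MonoidAlgebra.basis G k).constr k f

theorem linExt_of {G M : Type*} [Group G] [AddCommMonoid M] [Module k M] (f : G → M) (g : G) :
    linExt k f (.of k G g) = f g := by
  have h := (MonoidAlgebra.basis G k).constr_basis k f g
  exact h

/-- These are coordinate maps: applied to `∑ a_j (x_{j5} - 1)`, the map `D` returns `a_i`. It is the
Fox derivative on `F₃`, extended to each coset of the kernel by left translation. -/
theorem exists_dual (i : Fin 3) : ∃ D : KP k →ₗ[k] KP k, ∀ a j,
    D (a * x5Sub k j) = if j = i then a else 0 := by
  obtain ⟨d, hd, hd'⟩ := exists_crossed ((MonoidAlgebra.of k P5).comp iota) 1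
    (fun j => if j = i then (1 : KP k) else 0)
  -- Each `g` is written `s(g) · iota (ν g)`, with the kernel factor on the right: multiplying by
  -- `x_{j5}` then fixes `s(g)` and multiplies `ν g` by a generator.
  let s : P5 → P5 := fun g => ellGrp (pr5 g)
  let ν : P5 → FreeGroup (Fin 3) := fun g => (semi ((s g)⁻¹ * g)).left
  have hs : ∀ g j, s (g * x5 j) = s g := fun g j => by simp [s, pr5_x5]
  have hr : ∀ g, (semi ((s g)⁻¹ * g)).right = 1 := fun g => by
    rw [semi_right]; simp [s, pr5_ellGrp]
  have hν : ∀ g j, ν (g * x5 j) = ν g * gen3 j := fun g j => by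
    simp only [ν, hs]
    rw [← mul_assoc, map_mul, SemidirectProduct.mul_left, hr, semi_x5]
    simp
  have hsν : ∀ g, s g * iota (ν g) = g := fun g => by
    have h := eq_iota_mul_ellGrp ((s g)⁻¹ * g)
    rw [← semi_right, hr, map_one, mul_one] at h
    rw [← h, mul_inv_cancel_left]
  refine ⟨linExt k fun g => .of k P5 (s g) * d (ν g), fun a j => ?_⟩
  induction a using MonoidAlgebra.induction_on with
  | of g =>
    rw [x5Sub, mul_sub, ← map_mul, mul_one, map_sub, linExt_of, linExt_of, hs, hν, hd, hd']
    simp only [MonoidHom.one_apply, mul_one, mul_add, add_sub_cancel_right, mul_ite, mul_zero,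
      MonoidHom.comp_apply, ← map_mul, hsν]
  | add a b ha hb =>
    rw [add_mul, map_add, ha, hb]
    split_ifs <;> simp
  | smul c a ha =>
    rw [smul_mul_assoc, map_smul, ha]
    split_ifs <;> simp

/-- The identities `gh - 1 = g (h - 1) + (g - 1)` and `g⁻¹ - 1 = -g⁻¹ (g - 1)` reduce a word in the
`x_{i5}` to its letters. -/
theorem mem_span_of_kernel (g : P5) (hg : pr5 g = 1) :
    MonoidAlgebra.of k P5 g - 1 ∈ Ideal.span (Set.range (x5Sub k)) := by
  have key : ∀ w, MonoidAlgebra.of k P5 (iota w) - 1 ∈ Ideal.span (Set.range (x5Sub k)) := by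
    intro w
    have hinv : ∀ h : P5, MonoidAlgebra.of k P5 h - 1 ∈ Ideal.span (Set.range (x5Sub k)) →
        MonoidAlgebra.of k P5 h⁻¹ - 1 ∈ Ideal.span (Set.range (x5Sub k)) := by
      intro h hh
      have h1 : MonoidAlgebra.of k P5 h⁻¹ - 1 =
          -MonoidAlgebra.of k P5 h⁻¹ * (MonoidAlgebra.of k P5 h - 1) := by
        rw [mul_sub, neg_mul, ← map_mul, inv_mul_cancel, map_one]
        simp [sub_eq_add_neg, add_comm]
      rw [h1]
      exact Ideal.mul_mem_left _ _ hh
    induction w using FreeGroup.induction_on with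
    | C1 => simp [MonoidAlgebra.one_def]
    | of i => rw [iota_of i]; exact Ideal.subset_span ⟨i, rfl⟩
    | inv_of i h => rw [map_inv]; exact hinv _ h
    | mul x y hx hy =>
      have h1 : MonoidAlgebra.of k P5 (iota (x * y)) - 1 =
          MonoidAlgebra.of k P5 (iota x) * (MonoidAlgebra.of k P5 (iota y) - 1) +
            (MonoidAlgebra.of k P5 (iota x) - 1) := by
        rw [mul_sub, map_mul, map_mul, mul_one, sub_add_sub_cancel]
      rw [h1]
      exact add_mem (Ideal.mul_mem_left _ _ hy) hx
  have h := eq_iota_mul_ellGrp g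
  rw [hg, map_one, mul_one] at h
  rw [h]
  exact key _

/-- Modulo the left ideal spanned by the `x_{i5} - 1`, every `x` equals `ell (pr₅ x)`, which
vanishes on the kernel. -/
theorem J5_le_span : J5 k ≤ Ideal.span (Set.range (x5Sub k)) := by
  have key : ∀ x, x - ell k (pr5Alg k x) ∈ Ideal.span (Set.range (x5Sub k)) := by
    intro x
    induction x using MonoidAlgebra.induction_on with
    | of g =>
      have h : MonoidAlgebra.of k P5 g - ell k (pr5Alg k (.of k P5 g)) =
          .of k P5 (ellGrp (pr5 g)) * (.of k P5 ((ellGrp (pr5 g))⁻¹ * g) - 1) := by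
        rw [pr5Alg_of, ell_of, mul_sub, ← map_mul, mul_inv_cancel_left, mul_one]
      rw [h]
      exact Ideal.mul_mem_left _ _ (mem_span_of_kernel k _ (by simp [pr5_ellGrp]))
    | add a b ha hb =>
      rw [map_add, map_add, add_sub_add_comm]
      exact add_mem ha hb
    | smul c a ha =>
      rw [map_smul, map_smul, ← smul_sub, Algebra.smul_def]
      exact Ideal.mul_mem_left _ _ ha
  intro x hx
  have h := key x
  rw [J5, RingHom.mem_ker] at hx
  have hx' : pr5Alg k x = 0 := hx
  rwa [hx', map_zero, sub_zero] at h

theorem linearIndependent_x5Sub :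
    LinearIndependent (KP k) (fun i => (⟨x5Sub k i, x5Sub_mem k i⟩ : J5 k)) := by
  rw [Fintype.linearIndependent_iff]
  intro g hg i
  obtain ⟨D, hD⟩ := exists_dual k i
  have h := congrArg (fun x : J5 k => D (x : KP k)) hg
  simpa [hD] using h

/-- The basis `(x_{i5} - 1)` of `Ker(pr₅)`. -/
def basisJ5 : Module.Basis (Fin 3) (KP k) (J5 k) :=
  Module.Basis.mk (linearIndependent_x5Sub k) (by
    rintro ⟨x, hx⟩ _
    have h := J5_le_span k hx
    rw [Ideal.span, Submodule.mem_span_range_iff_exists_fun] at h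
    obtain ⟨c, hc⟩ := h
    rw [Submodule.mem_span_range_iff_exists_fun]
    exact ⟨c, Subtype.ext (by simpa using hc)⟩)

theorem basisJ5_apply (i : Fin 3) : (basisJ5 k i : KP k) = x5Sub k i := by
  simp [basisJ5]

end

section

/-! ### Augmentation filtrations -/

namespace AlgFiltration

section

variable {k A B : Type*} [CommRing k]

theorem mem_augmentation_one [Ring A] [Bialgebra k A] {a : A} :
    a ∈ (augmentation k A).sub 1 ↔ Bialgebra.counitAlgHom k A a = 0 := by
  change a ∈ (RingHom.ker (Bialgebra.counitAlgHom k A)) ^ 1 ↔ _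
  rw [Submodule.pow_one, RingHom.mem_ker]

/-- This is `I^{n+1} = I^n · I`; the variant below uses `I · I^n`. The two serve left and right Fox
derivatives respectively. -/
theorem augmentation_succ_induction [Ring A] [Bialgebra k A] {n : ℕ} {p : A → Prop}
    (mul : ∀ a ∈ (augmentation k A).sub n, ∀ b, Bialgebra.counitAlgHom k A b = 0 → p (a * b))
    (add : ∀ a b, p a → p b → p (a + b)) {x : A} (hx : x ∈ (augmentation k A).sub (n + 1)) :
    p x := by
  change x ∈ (RingHom.ker (Bialgebra.counitAlgHom k A)) ^ (n + 1) at hx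
  rw [Ideal.IsTwoSided.pow_add, Submodule.pow_one] at hx
  exact Submodule.smul_induction_on hx (fun a ha b hb => mul a ha b hb) add

theorem augmentation_succ_induction_left [Ring A] [Bialgebra k A] {n : ℕ} {p : A → Prop}
    (mul : ∀ a, Bialgebra.counitAlgHom k A a = 0 → ∀ b ∈ (augmentation k A).sub n, p (a * b))
    (add : ∀ a b, p a → p b → p (a + b)) {x : A} (hx : x ∈ (augmentation k A).sub (n + 1)) :
    p x := by
  change x ∈ (RingHom.ker (Bialgebra.counitAlgHom k A)) ^ (n + 1) at hx
  rw [add_comm, Ideal.IsTwoSided.pow_add, Submodule.pow_one] at hx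
  exact Submodule.smul_induction_on hx (fun a ha b hb => mul a ha b hb) add

/-- A morphism mapping the augmentation ideal to `F 1` is compatible with the filtrations. -/
theorem hasShift_augmentation [Ring A] [Bialgebra k A] [Ring B] [Algebra k B]
    (G : AlgFiltration k B) (f : A →ₐ[k] B)
    (h : ∀ a, Bialgebra.counitAlgHom k A a = 0 → f a ∈ G.sub 1) :
    HasShift (augmentation k A) G 0 f.toLinearMap := by
  intro n
  induction n with
  | zero => intro a _; rw [add_zero, G.sub_zero]; trivial
  | succ n ih =>
    intro a ha
    refine augmentation_succ_induction (p := fun a => f.toLinearMap a ∈ G.sub (n + 1 + 0))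
      (fun a ha b hb => ?_) (fun a b ha hb => ?_) ha
    · rw [AlgHom.toLinearMap_apply, map_mul]
      exact G.mul_mem n 1 _ _ (ih a ha) (h b hb)
    · rw [map_add]
      exact add_mem ha hb

/-- A representative can be followed through a chain of completed maps, which reduces identities
between them to identities before completion. -/
theorem HasShift.mkQ_eq_map_apply [NonUnitalRing A] [Module k A] [NonUnitalRing B] [Module k B]
    {F : AlgFiltration k A} {G : AlgFiltration k B} {d : ℕ} {f : A →ₗ[k] B}
    (h : HasShift F G d f) {x : F.completion} {n : ℕ} {a : A} (hx : (F.sub n).mkQ a = x.1 n) :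
    (G.sub n).mkQ (f a) = (h.map x).1 n := by
  change _ = (F.sub n).mapQ (G.sub n) f (h.le_comap n) (x.1 n)
  rw [← hx]
  rfl

theorem HasShift.map_mul [NonUnitalRing A] [Module k A] [NonUnitalRing B] [Module k B]
    [IsScalarTower k A A] [SMulCommClass k A A] [IsScalarTower k B B] [SMulCommClass k B B]
    {F : AlgFiltration k A} {G : AlgFiltration k B} {d : ℕ} {f : A →ₗ[k] B}
    (h : HasShift F G d f) (hf : ∀ a b, f (a * b) = f a * f b) (x y : F.completion) :
    h.map (x * y) = h.map x * h.map y := by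
  refine Subtype.ext (funext fun n => ?_)
  obtain ⟨a, ha⟩ := (F.sub n).mkQ_surjective (x.1 n)
  obtain ⟨b, hb⟩ := (F.sub n).mkQ_surjective (y.1 n)
  change (F.sub n).mapQ (G.sub n) f (h.le_comap n) (F.quotMul n (x.1 n) (y.1 n)) =
    G.quotMul n ((F.sub n).mapQ (G.sub n) f (h.le_comap n) (x.1 n))
      ((F.sub n).mapQ (G.sub n) f (h.le_comap n) (y.1 n))
  rw [← ha, ← hb]
  exact congrArg (G.sub n).mkQ (hf a b)

theorem hasShift_tensor_map {A' B' : Type*} [Ring A] [Algebra k A] [Ring B] [Algebra k B]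
    [Ring A'] [Algebra k A'] [Ring B'] [Algebra k B']
    {F : AlgFiltration k A} {G : AlgFiltration k B} {F' : AlgFiltration k A'}
    {G' : AlgFiltration k B'} {f : A →ₗ[k] A'} {g : B →ₗ[k] B'}
    (hf : HasShift F F' 0 f) (hg : HasShift G G' 0 g) :
    HasShift (F.tensor G) (F'.tensor G') 0 (TensorProduct.map f g) := by
  intro n x hx
  induction hx using Submodule.span_induction with
  | mem x hx =>
    obtain ⟨i, j, a, b, hij, ha, hb, rfl⟩ := hx
    exact Submodule.subset_span ⟨i, j, f a, g b, hij, hf i a ha, hg j b hb, rfl⟩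
  | zero => rw [map_zero]; exact zero_mem _
  | add x y _ _ hx hy => rw [map_add]; exact add_mem hx hy
  | smul c x _ hx => rw [map_smul]; exact Submodule.smul_mem _ c hx

/-- It suffices to treat the augmentation ideal, by `a ⊗ b - ε(a) ε(b) = (a - ε(a)) ⊗ b + ε(a) ⊗ (b
- ε(b))`. -/
theorem hasShift_augmentation_tensor [Ring A] [Bialgebra k A] [Ring B] [Bialgebra k B] :
    HasShift (augmentation k (A ⊗[k] B)) ((augmentation k A).tensor (augmentation k B)) 0
      LinearMap.id := by
  refine hasShift_augmentation _ (AlgHom.id k (A ⊗[k] B)) fun a ha => ?_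
  have key : ∀ a : A ⊗[k] B, a - algebraMap k _ (Bialgebra.counitAlgHom k (A ⊗[k] B) a) ∈
      ((augmentation k A).tensor (augmentation k B)).sub 1 := by
    intro x
    induction x using TensorProduct.induction_on with
    | zero => simp
    | add x y hx hy =>
      rw [map_add, map_add, add_sub_add_comm]
      exact add_mem hx hy
    | tmul a b =>
      have h : a ⊗ₜ[k] b - algebraMap k _ (Bialgebra.counitAlgHom k (A ⊗[k] B) (a ⊗ₜ[k] b)) =
          (a - algebraMap k A (Bialgebra.counitAlgHom k A a)) ⊗ₜ[k] b +
          algebraMap k A (Bialgebra.counitAlgHom k A a) ⊗ₜ[k]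
            (b - algebraMap k B (Bialgebra.counitAlgHom k B b)) := by
        rw [TensorProduct.sub_tmul, TensorProduct.tmul_sub, sub_add_sub_cancel]
        congr 1
        simp [Algebra.algebraMap_eq_smul_one, TensorProduct.smul_tmul', TensorProduct.tmul_smul,
          Algebra.TensorProduct.one_def, smul_smul, mul_comm]
      rw [h]
      refine add_mem (Submodule.subset_span ⟨1, 0, _, _, rfl, ?_, ?_, rfl⟩)
        (Submodule.subset_span ⟨0, 1, _, _, rfl, ?_, ?_, rfl⟩)
      · rw [mem_augmentation_one]; simp
      · rw [(augmentation k B).sub_zero]; trivial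
      · rw [(augmentation k A).sub_zero]; trivial
      · rw [mem_augmentation_one]; simp
  have h := key a
  rwa [ha, map_zero, _root_.sub_zero] at h

end

end AlgFiltration

open AlgFiltration

variable (k : Type*) [CommRing k]

/-! ### Fox derivatives on `k F₂`, division by `X₁ - 1` and the retraction on `W_r` -/

theorem counit_of {G : Type*} [Group G] (g : G) :
    Bialgebra.counitAlgHom k (MonoidAlgebra k G) (.of k G g) = 1 := by
  simp

theorem counit_e1 : Bialgebra.counitAlgHom k (KF k) (e1 k) = 0 := by
  simp [e1, grp]

theorem algHom_ext_of {G B : Type*} [Group G] [Semiring B] [Algebra k B]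
    {f g : MonoidAlgebra k G →ₐ[k] B} (h : ∀ x, f (.of k G x) = g (.of k G x)) : f = g :=
  MonoidAlgebra.algHom_ext h (by ext)

/-- The left Fox derivative with respect to `X₁`. -/
theorem exists_leftFox : ∃ d : KF k →ₗ[k] KF k, d (e1 k) = 1 ∧
    ∀ a b, d (a * b) = a * d b + Bialgebra.counitAlgHom k (KF k) b • d a := by
  obtain ⟨d, hd, hd'⟩ := exists_crossed (MonoidAlgebra.of k F2) 1
    (fun j => if j = 1 then (1 : KF k) else 0)
  have h1 : d 1 = 0 := by simpa [← MonoidAlgebra.one_def] using hd 1 1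
  refine ⟨linExt k d, ?_, fun a b => ?_⟩
  · rw [e1, map_sub, grp, linExt_of, X1, hd', ← map_one (MonoidAlgebra.of k F2), linExt_of, h1]
    simp
  · induction a using MonoidAlgebra.induction_on with
    | of g =>
      induction b using MonoidAlgebra.induction_on with
      | of h => rw [← map_mul, linExt_of, linExt_of, linExt_of, hd, counit_of]; simp
      | add a b ha hb => rw [mul_add, map_add, ha, hb, map_add, mul_add, map_add, add_smul]; abel
      | smul c a ha =>
        rw [mul_smul_comm, map_smul, ha, map_smul, map_smul, mul_smul_comm, smul_add, smul_assoc]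
    | add a a' ha ha' => rw [add_mul, map_add, ha, ha', map_add, add_mul, smul_add]; abel
    | smul c a ha =>
      rw [smul_mul_assoc, map_smul, ha, map_smul, smul_mul_assoc, smul_add, smul_comm c]

/-- The right Fox derivative with respect to `X₁`. -/
theorem exists_rightFox : ∃ d : KF k →ₗ[k] KF k, d (e1 k) = 1 ∧ d 1 = 0 ∧
    ∀ a b, d (a * b) = Bialgebra.counitAlgHom k (KF k) a • d b + d a * b := by
  obtain ⟨d, hd, hd'⟩ := exists_crossed 1 (MonoidAlgebra.of k F2)
    (fun j => if j = 1 then (1 : KF k) else 0)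
  have h1 : d 1 = 0 := by simpa [← MonoidAlgebra.one_def] using hd 1 1
  have h1' : linExt k d 1 = 0 := by rw [← map_one (MonoidAlgebra.of k F2), linExt_of, h1]
  refine ⟨linExt k d, ?_, h1', fun a b => ?_⟩
  · rw [e1, map_sub, grp, linExt_of, X1, hd', h1']
    simp
  · induction a using MonoidAlgebra.induction_on with
    | of g =>
      induction b using MonoidAlgebra.induction_on with
      | of h => rw [← map_mul, linExt_of, linExt_of, linExt_of, hd, counit_of]; simp
      | add a b ha hb => rw [mul_add, map_add, ha, hb, map_add, mul_add, smul_add]; abel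
      | smul c a ha =>
        rw [mul_smul_comm, map_smul, ha, map_smul, mul_smul_comm, smul_add, smul_comm c]
    | add a a' ha ha' => rw [add_mul, map_add, ha, ha', map_add, map_add, add_mul, add_smul]; abel
    | smul c a ha =>
      rw [smul_mul_assoc, map_smul, ha, map_smul, map_smul, smul_mul_assoc, smul_add, smul_assoc]

theorem isLeftRegular_e1 : IsLeftRegular (e1 k) := by
  obtain ⟨d, hd, -, hmul⟩ := exists_rightFox k
  have key : ∀ a, d (e1 k * a) = a := fun a => by rw [hmul, counit_e1, hd, zero_smul, zero_add, one_mul]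
  exact fun a b hab => by rw [← key a, ← key b]; exact congrArg d hab

/-- The left Fox derivative sends `a (X₁ - 1)` to `a` and `I^{n+1}` to `I^n`. -/
theorem mem_of_mul_e1_mem {n : ℕ} {a : KF k} (h : a * e1 k ∈ (filKF k).sub (n + 1)) :
    a ∈ (filKF k).sub n := by
  obtain ⟨d, hd, hmul⟩ := exists_leftFox k
  have key : d (a * e1 k) = a := by rw [hmul, counit_e1, hd, zero_smul, add_zero, mul_one]
  rw [← key]
  refine augmentation_succ_induction (p := fun x => d x ∈ (filKF k).sub n)
    (fun a ha b hb => ?_) (fun a b ha hb => by rw [map_add]; exact add_mem ha hb) h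
  rw [hmul, hb, zero_smul, add_zero]
  exact (filKF k).mul_mem_right n _ ha

/-- A retraction of `k F₂` on `W_r`, compatible with the filtrations. -/
theorem exists_retraction : ∃ r : KF k →ₗ[k] Wr k, (∀ w : Wr k, r w = w) ∧
    (filKF k).HasShift (filWr k) 0 r := by
  obtain ⟨d, hd, hd1, hmul⟩ := exists_rightFox k
  -- The retraction is `a ↦ ε(a) + (X₁ - 1) d(a)`, with `d` the right Fox derivative, which divides
  -- by `X₁ - 1` on the left.
  refine ⟨{ toFun := fun a => ⟨algebraMap k _ (Bialgebra.counitAlgHom k (KF k) a) + e1 k * d a,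
              _, _, rfl⟩
            map_add' := fun a b => Subtype.ext (by
              simp only [map_add, mul_add, Subalgebra.coe_add]; abel)
            map_smul' := fun c a => Subtype.ext (by
              simp only [map_smul, mul_smul_comm, RingHom.id_apply, Subalgebra.coe_smul, smul_add,
                smul_eq_mul, _root_.map_mul, Algebra.smul_def c (algebraMap k _ _)]) }, ?_, ?_⟩
  · rintro ⟨_, c, a, rfl⟩
    have hdc : d (algebraMap k _ c) = 0 := by
      rw [Algebra.algebraMap_eq_smul_one, map_smul, hd1, smul_zero]
    refine Subtype.ext ?_
    change algebraMap k _ (Bialgebra.counitAlgHom k (KF k) (algebraMap k _ c + e1 k * a)) +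
      e1 k * d (algebraMap k _ c + e1 k * a) = _
    rw [map_add, _root_.map_mul, counit_e1, zero_mul, add_zero, AlgHom.commutes, map_add, hmul,
      counit_e1, hd, zero_smul, zero_add, one_mul, hdc, zero_add]
    rfl
  · intro n a ha
    change algebraMap k _ (Bialgebra.counitAlgHom k (KF k) a) + e1 k * d a ∈ (filKF k).sub n
    cases n with
    | zero => rw [(filKF k).sub_zero]; trivial
    | succ n =>
      have h0 : Bialgebra.counitAlgHom k (KF k) a = 0 :=
        mem_augmentation_one.1 ((filKF k).antitone (Nat.le_add_left 1 n) ha)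
      have h1 : d a ∈ (filKF k).sub n := by
        refine augmentation_succ_induction_left (p := fun x => d x ∈ (filKF k).sub n)
          (fun a ha b hb => ?_) (fun a b ha hb => by rw [map_add]; exact add_mem ha hb) ha
        rw [hmul, ha, zero_smul, zero_add]
        exact (filKF k).mul_mem_left n _ hb
      rw [h0, map_zero, zero_add, add_comm n]
      exact (filKF k).mul_mem 1 n _ _ (e1_mem_filKF k) h1

/-- Tensoring the retraction with itself gives a left inverse, so no flatness over `k` is required.
-/
theorem inclRight_injective : Function.Injective (inclRight k) := by
  obtain ⟨r, hr, -⟩ := exists_retraction k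
  refine Function.LeftInverse.injective (g := TensorProduct.map r r) fun x => ?_
  induction x using TensorProduct.induction_on with
  | zero => simp
  | tmul a b => simp [inclRight, hr]
  | add x y hx hy => rw [map_add, map_add, hx, hy]

/-- Strictness of the inclusion: the tensor square of the retraction is filtered and undoes `incl`.
-/
theorem mem_tensor_of_inclRight {n : ℕ} {x : Wr k ⊗[k] Wr k}
    (h : inclRight k x ∈ (filKFKF k).sub n) : x ∈ ((filWr k).tensor (filWr k)).sub n := by
  obtain ⟨r, hr, hr'⟩ := exists_retraction k
  have hx : ∀ x, TensorProduct.map r r (inclRight k x) = x := fun x => by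
    induction x using TensorProduct.induction_on with
    | zero => simp
    | tmul a b => simp [inclRight, hr]
    | add x y hx hy => rw [map_add, map_add, hx, hy]
  rw [← hx x]
  exact hasShift_tensor_map hr' hr' n _ (hasShift_augmentation_tensor n _ h)

theorem hasShift_inclRight :
    ((filWr k).tensor (filWr k)).HasShift (filKFKF k) 0 (inclRight k).toLinearMap := by
  have hL : (filKF k).HasShift (filKFKF k) 0
      (Algebra.TensorProduct.includeLeft : KF k →ₐ[k] KFKF k).toLinearMap :=
    hasShift_augmentation _ _ fun a ha => mem_augmentation_one.2 (by simpa using ha)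
  have hR : (filKF k).HasShift (filKFKF k) 0
      (Algebra.TensorProduct.includeRight : KF k →ₐ[k] KFKF k).toLinearMap :=
    hasShift_augmentation _ _ fun a ha => mem_augmentation_one.2 (by simpa using ha)
  intro n x hx
  induction hx using Submodule.span_induction with
  | mem x hx =>
    obtain ⟨i, j, a, b, hij, ha, hb, rfl⟩ := hx
    have h := (filKFKF k).mul_mem i j _ _ (hL i _ ha) (hR j _ hb)
    rw [hij] at h
    have h2 : inclRight k (a ⊗ₜ[k] b) = ((a : KF k) ⊗ₜ[k] 1) * (1 ⊗ₜ[k] (b : KF k)) := by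
      simp [inclRight]
    rw [AlgHom.toLinearMap_apply, h2]
    exact h
  | zero => rw [map_zero]; exact zero_mem _
  | add x y _ _ hx hy => rw [map_add]; exact add_mem hx hy
  | smul c x _ hx => rw [map_smul]; exact Submodule.smul_mem _ c hx

theorem hasShift_twist :
    (filKF k).HasShift (filTwisted k) 1 (twist k : KF k →ₗ[k] Twisted (e1 k)) :=
  fun _ a ha => ⟨a, ha, rfl⟩

theorem hasShift_mor : (filTwisted k).HasShift (filWlPlus k) 0 (toLin (mor k)) := by
  rintro n _ ⟨a, ha, rfl⟩
  change a * e1 k ∈ (filKF k).sub n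
  cases n with
  | zero => rw [(filKF k).sub_zero]; trivial
  | succ n => exact (filKF k).mul_mem n 1 _ _ ha (e1_mem_filKF k)

theorem mor_bijective : Function.Bijective (mor k) :=
  ⟨fun _ _ h => isRightRegular_e1 k (congrArg Subtype.val h), fun ⟨_, a, h⟩ =>
    ⟨twist k a, Subtype.ext h.symm⟩⟩

end

section

/-! ### Morphisms with source `W_l` -/

section

variable {k A B : Type*} [CommRing k] [Ring A] [Algebra k A] [Ring B] [Algebra k B]

/-- The condition on `R` says that it is multiplicative for the product `a e b`. As `W_l` is `A e`
with a unit adjoined, such an `R` extends uniquely to a unital morphism. -/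
theorem exists_leftSub_lift {e : A} (he : IsRightRegular e) (ε : A →ₐ[k] k) (hε : ε e = 0)
    (R : A →ₗ[k] B) (hR : ∀ a b, R (a * e * b) = R a * R b) :
    ∃ Φ : leftSub k e →ₐ[k] B, ∀ c a (h : algebraMap k A c + a * e ∈ leftSub k e),
      Φ ⟨algebraMap k A c + a * e, h⟩ = algebraMap k B c + R a := by
  -- Since `ε` kills `e`, it reads off the scalar part; regularity of `e` then makes the other
  -- component `g w` unique.
  have hex : ∀ w : leftSub k e, ∃ a : A, (w : A) = algebraMap k A (ε w) + a * e := by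
    rintro ⟨_, c, a, rfl⟩
    refine ⟨a, ?_⟩
    simp only [map_add, map_mul, hε, mul_zero, add_zero, AlgHom.commutes, Algebra.algebraMap_self,
      RingHom.id_apply]
  choose g hg using hex
  have huniq : ∀ (w : leftSub k e) a, (w : A) = algebraMap k A (ε w) + a * e → g w = a := by
    intro w a h
    have h1 := hg w
    exact he (add_left_cancel (h1.symm.trans h))
  have hadd : ∀ v w, g (v + w) = g v + g w := fun v w => huniq _ _ (by
    conv_lhs => rw [Subalgebra.coe_add, hg v, hg w]
    rw [Subalgebra.coe_add, map_add, map_add, add_mul]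
    abel)
  have hsmul : ∀ (c : k) w, g (c • w) = c • g w := fun c w => huniq _ _ (by
    conv_lhs => rw [Subalgebra.coe_smul, hg w]
    rw [Subalgebra.coe_smul, map_smul, smul_add, smul_mul_assoc, smul_eq_mul, map_mul,
      ← Algebra.smul_def])
  have hone : g 1 = 0 := huniq _ _ (by simp)
  have hmul : ∀ v w, g (v * w) = ε v • g w + ε w • g v + g v * e * g w := fun v w => huniq _ _ (by
    conv_lhs => rw [Subalgebra.coe_mul, hg v, hg w]
    rw [Subalgebra.coe_mul, map_mul, map_mul]
    simp only [add_mul, mul_add, Algebra.smul_def, mul_assoc]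
    rw [← Algebra.commutes (ε w) e, ← mul_assoc (g v), ← Algebra.commutes (ε w) (g v), mul_assoc]
    abel)
  refine ⟨AlgHom.ofLinearMap
    { toFun := fun w => algebraMap k B (ε w) + R (g w)
      map_add' := fun v w => by
        rw [hadd, Subalgebra.coe_add, map_add, map_add, map_add]; abel
      map_smul' := fun c w => by
        rw [hsmul, Subalgebra.coe_smul, map_smul ε, map_smul R, RingHom.id_apply, smul_add,
          smul_eq_mul, map_mul, ← Algebra.smul_def] } (by simp [hone]) ?_, ?_⟩
  · intro v w
    change algebraMap k B (ε (v * w : A)) + R (g (v * w)) = (algebraMap k B (ε v) + R (g v)) *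
      (algebraMap k B (ε w) + R (g w))
    rw [hmul, map_add, map_add, map_smul, map_smul, hR, map_mul, map_mul, Algebra.smul_def,
      Algebra.smul_def, add_mul, mul_add, mul_add, Algebra.commutes (ε w) (R (g v))]
    abel
  · intro c a h
    have h1 : ε (algebraMap k A c + a * e) = c := by
      simp only [map_add, map_mul, hε, mul_zero, add_zero, AlgHom.commutes,
        Algebra.algebraMap_self, RingHom.id_apply]
    have h2 : g ⟨algebraMap k A c + a * e, h⟩ = a := huniq _ _ (by simp only [h1])
    change algebraMap k B (ε (algebraMap k A c + a * e)) +
      R (g ⟨algebraMap k A c + a * e, h⟩) = _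
    rw [h1, h2]

theorem adLeft_eq {e : A} (he : IsRightRegular e) {w : leftSub k e} {v : A}
    (h : v * e = e * w) : (adLeft k e he w : A) = v :=
  he (((exists_adLeft k e w).choose_spec).trans h.symm)

theorem adLeft_bijective {e : A} (he : IsRightRegular e) (he' : IsLeftRegular e) :
    Function.Bijective (adLeft k e he) := by
  refine ⟨fun v w h => Subtype.ext (he' ?_), ?_⟩
  · change e * (v : A) = e * (w : A)
    rw [← (exists_adLeft k e v).choose_spec, ← (exists_adLeft k e w).choose_spec]
    exact congrArg (fun x : rightSub k e => (x : A) * e) h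
  · rintro ⟨_, c, a, rfl⟩
    exact ⟨⟨algebraMap k A c + a * e, c, a, rfl⟩, Subtype.ext (adLeft_apply k e he c a _)⟩

theorem conj_injective (u : Aˣ) : Function.Injective (conj k u) := fun _ _ h =>
  (Units.mul_right_inj u).1 ((Units.mul_left_inj u⁻¹).1 h)

end

variable (k : Type*) [CommRing k]

/-- The element `(X₀^s - 1)^{n-1} X₀^s` of `k F₂`. -/
def powX0 (s : ℤˣ) (n : ℕ) : KF k :=
  (grp k (X0 ^ (s : ℤ)) - 1) ^ (n - 1) * grp k (X0 ^ (s : ℤ))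

theorem coe_Yl (s : ℤˣ) (n : ℕ) :
    (Yl k s n : KF k) = powX0 k s n * (1 - grp k (X1 ^ (s : ℤ))) := rfl

theorem powX0_one (s : ℤˣ) : powX0 k s 1 = grp k (X0 ^ (s : ℤ)) := by
  simp [powX0]

theorem powX0_succ (s : ℤˣ) {n : ℕ} (hn : 1 ≤ n) :
    powX0 k s (n + 1) = (grp k (X0 ^ (s : ℤ)) - 1) * powX0 k s n := by
  obtain ⟨n, rfl⟩ := Nat.exists_eq_add_of_le' hn
  simp only [powX0, Nat.add_sub_cancel, pow_succ', mul_assoc]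

theorem grp_mul (g h : F2) : grp k (g * h) = grp k g * grp k h := map_mul _ _ _

theorem grp_one : grp k 1 = 1 := map_one _

/-- `W_l` is generated by the elements `X₁^s` and `Y_n^s`. -/
theorem eq_top_of_generators_mem (S : Subalgebra k (Wl k)) (h1 : ∀ s, X1l k s ∈ S)
    (h2 : ∀ s n, 1 ≤ n → Yl k s n ∈ S) : S = ⊤ := by
  let T : Subalgebra k (KF k) := S.map (Wl k).val
  have hX : ∀ s : ℤˣ, grp k (X1 ^ (s : ℤ)) ∈ T := fun s => ⟨_, h1 s, rfl⟩
  have hX1 : grp k X1 ∈ T := by simpa using hX 1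
  have hX1' : grp k X1⁻¹ ∈ T := by simpa using hX (-1)
  have hY : ∀ s : ℤˣ, ∀ n, (grp k (X0 ^ (s : ℤ)) - 1) ^ n * grp k (X0 ^ (s : ℤ)) *
      (1 - grp k (X1 ^ (s : ℤ))) ∈ T := fun s n => ⟨_, h2 s (n + 1) (by omega), rfl⟩
  -- Writing `X₀^s = (X₀^s - 1) + 1` trades a power of `X₀^s` for a larger index of `Y_n^s`.
  have hpow : ∀ s : ℤˣ, ∀ j n, grp k (X0 ^ (s : ℤ)) ^ j * ((grp k (X0 ^ (s : ℤ)) - 1) ^ n *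
      grp k (X0 ^ (s : ℤ)) * (1 - grp k (X1 ^ (s : ℤ)))) ∈ T := by
    intro s j
    induction j with
    | zero => intro n; rw [pow_zero, one_mul]; exact hY s n
    | succ j ih =>
      intro n
      have h := add_mem (ih (n + 1)) (ih n)
      rw [pow_succ' _ n, mul_assoc (_ - 1) , mul_assoc (_ - 1), sub_mul, one_mul, mul_sub,
        sub_add_cancel, ← mul_assoc (_ ^ j), ← pow_succ] at h
      exact h
  have he : e1 k ∈ T := sub_mem hX1 (one_mem _)
  have hpos : ∀ n : ℕ, grp k (X0 ^ n) * e1 k ∈ T := by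
    intro n
    rcases n with _ | n
    · rw [pow_zero, grp_one, one_mul]; exact he
    · have h := neg_mem (hpow 1 n 0)
      have h3 : grp k (X0 ^ (n + 1)) * e1 k = -(grp k (X0 ^ ((1 : ℤˣ) : ℤ)) ^ n *
          ((grp k (X0 ^ ((1 : ℤˣ) : ℤ)) - 1) ^ 0 * grp k (X0 ^ ((1 : ℤˣ) : ℤ)) *
          (1 - grp k (X1 ^ ((1 : ℤˣ) : ℤ))))) := by
        rw [pow_zero, one_mul, ← mul_assoc, ← pow_succ, ← mul_neg, neg_sub]
        simp [grp, e1]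
      rw [h3]; exact h
  have hneg : ∀ n : ℕ, grp k (X0⁻¹ ^ n) * e1 k ∈ T := by
    intro n
    rcases n with _ | n
    · rw [pow_zero, grp_one, one_mul]; exact he
    · have h := mul_mem (hpow (-1) n 0) hX1
      have h3 : grp k (X0⁻¹ ^ (n + 1)) * e1 k = (grp k (X0 ^ ((-1 : ℤˣ) : ℤ)) ^ n *
          ((grp k (X0 ^ ((-1 : ℤˣ) : ℤ)) - 1) ^ 0 * grp k (X0 ^ ((-1 : ℤˣ) : ℤ)) *
          (1 - grp k (X1 ^ ((-1 : ℤˣ) : ℤ))))) * grp k X1 := by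
        rw [pow_zero, one_mul, ← mul_assoc, ← pow_succ, mul_assoc, sub_mul, ← grp_mul, one_mul]
        simp [grp, e1, MonoidAlgebra.one_def]
      rw [h3]; exact h
  have hint : ∀ m : ℤ, grp k (X0 ^ m) * e1 k ∈ T := by
    intro m
    rcases Int.eq_nat_or_neg m with ⟨n, rfl | rfl⟩
    · simpa using hpos n
    · simpa using hneg n
  -- The elements `w` with `X₀^m w ∈ T` for all `m ∈ ℤ` are stable under left multiplication by
  -- `F₂`. For `X₁^{±1}` this uses `X₁ = (X₁ - 1) + 1` and `X₀^m (X₁ - 1) ∈ T`. Applied to `w = X₁ -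
  -- 1`, it yields all of `k F₂ (X₁ - 1)`.
  have key : ∀ g : F2, ∀ w, (∀ m : ℤ, grp k (X0 ^ m) * w ∈ T) →
      ∀ m : ℤ, grp k (X0 ^ m) * (grp k g * w) ∈ T := by
    intro g
    have hw : ∀ w, (∀ m : ℤ, grp k (X0 ^ m) * w ∈ T) → w ∈ T := fun w h => by
      simpa [grp_one] using h 0
    induction g using FreeGroup.induction_on with
    | C1 => intro w h m; rw [grp_one, one_mul]; exact h m
    | of i =>
      intro w h m
      fin_cases i
      · change grp k (X0 ^ m) * (grp k X0 * w) ∈ T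
        rw [← mul_assoc, ← grp_mul, ← zpow_add_one]
        exact h _
      · change grp k (X0 ^ m) * (grp k X1 * w) ∈ T
        have h3 : grp k (X0 ^ m) * (grp k X1 * w) =
            grp k (X0 ^ m) * e1 k * w + grp k (X0 ^ m) * w := by
          rw [e1]; noncomm_ring
        rw [h3]
        exact add_mem (mul_mem (hint m) (hw w h)) (h m)
    | inv_of i _ =>
      intro w h m
      fin_cases i
      · change grp k (X0 ^ m) * (grp k X0⁻¹ * w) ∈ T
        rw [← mul_assoc, ← grp_mul, ← zpow_sub_one]
        exact h _
      · change grp k (X0 ^ m) * (grp k X1⁻¹ * w) ∈ T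
        have h3 : grp k (X0 ^ m) * (grp k X1⁻¹ * w) =
            grp k (X0 ^ m) * w - grp k (X0 ^ m) * e1 k * (grp k X1⁻¹ * w) := by
          rw [e1, mul_sub, sub_mul, mul_assoc _ (grp k X1), ← mul_assoc (grp k X1), ← grp_mul,
            mul_inv_cancel, grp_one]
          noncomm_ring
        rw [h3]
        exact sub_mem (h m) (mul_mem (hint m) (mul_mem hX1' (hw w h)))
    | mul x y hx hy =>
      intro w h m
      rw [grp_mul, mul_assoc]
      exact hx _ (hy w h) m
  have hall : ∀ a, a * e1 k ∈ T := by
    intro a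
    induction a using MonoidAlgebra.induction_on with
    | of g =>
      change grp k g * e1 k ∈ T
      simpa [grp_one] using key g _ hint 0
    | add a b ha hb => rw [add_mul]; exact add_mem ha hb
    | smul c a ha => rw [smul_mul_assoc]; exact T.smul_mem ha c
  rw [eq_top_iff]
  rintro ⟨_, c, a, rfl⟩ -
  obtain ⟨w, hw, hw'⟩ := add_mem (T.algebraMap_mem c) (hall a)
  have h3 : w = ⟨algebraMap k (KF k) c + a * e1 k, c, a, rfl⟩ := Subtype.ext hw'
  rw [← h3]
  exact hw

end

section

/-! ### The matrices of the generators -/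

variable (k : Type*) [CommRing k]

theorem varpi_apply_eq (p : KP k) (i : Fin 3) (c : Fin 3 → KP k)
    (h : x5Sub k i * p = ∑ j, c j * x5Sub k j) : varpi k (basisJ5 k) p i = c := by
  have h1 : (⟨(basisJ5 k i : KP k) * p, (J5 k).mul_mem_right p (basisJ5 k i).2⟩ : J5 k) =
      ∑ j, c j • basisJ5 k j := Subtype.ext (by
    rw [Submodule.coe_sum]
    simpa [basisJ5_apply] using h)
  funext j
  change (basisJ5 k).repr ⟨(basisJ5 k i : KP k) * p, (J5 k).mul_mem_right p (basisJ5 k i).2⟩ j = _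
  rw [h1, Module.Basis.repr_sum_self]

/-- The element of `k P₅^*` attached to an element of `P₅^*`. -/
abbrev grpP (g : P5) : KP k := MonoidAlgebra.of k P5 g

/-- Row `i` expands `(x_{i5} - 1) x₁₂ = x₁₂ (x₁₂⁻¹ x_{i5} x₁₂ - 1)`: its last factor is a word in
the `x_{j5}` minus one, by `x12_conj` for `i = 1, 2` and by commutation for `i = 3`. The
coefficients are its Fox derivatives. The matrix of `x₂₃` arises likewise. -/
theorem varpi_x12 : varpi k (basisJ5 k) (grpP k (gen .x12)) =
    !![grpP k (gen .x12) * (1 + grpP k (x5 0 * x5 1) -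
          grpP k (x5 0 * x5 1 * x5 0 * (x5 1)⁻¹ * (x5 0)⁻¹)),
        grpP k (gen .x12) * (grpP k (x5 0) - grpP k (x5 0 * x5 1 * x5 0 * (x5 1)⁻¹)), 0;
      grpP k (gen .x12) * (1 - grpP k (x5 0 * x5 1 * (x5 0)⁻¹)),
        grpP k (gen .x12) * grpP k (x5 0), 0;
      0, 0, grpP k (gen .x12)] := by
  have h0 := x12_conj 0 commute_x34_x15
  have h1 := x12_conj 1 commute_x34_x25
  rw [mul_assoc, inv_mul_eq_iff_eq_mul] at h0 h1
  funext i
  refine varpi_apply_eq k _ i _ ?_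
  fin_cases i <;> rw [Fin.sum_univ_three]
  · change x5Sub k 0 * grpP k (gen .x12) = (grpP k (gen .x12) * (1 + grpP k (x5 0 * x5 1) -
          grpP k (x5 0 * x5 1 * x5 0 * (x5 1)⁻¹ * (x5 0)⁻¹))) * x5Sub k 0 +
        (grpP k (gen .x12) * (grpP k (x5 0) - grpP k (x5 0 * x5 1 * x5 0 * (x5 1)⁻¹))) *
        x5Sub k 1 + 0 * x5Sub k 2
    simp only [x5Sub, mul_sub, sub_mul, mul_add, add_mul, mul_one, one_mul, ← map_mul, zero_mul,
      h0, mul_assoc, mul_inv_rev, inv_mul_cancel]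
    abel
  · change x5Sub k 1 * grpP k (gen .x12) =
      (grpP k (gen .x12) * (1 - grpP k (x5 0 * x5 1 * (x5 0)⁻¹))) * x5Sub k 0 +
      (grpP k (gen .x12) * grpP k (x5 0)) * x5Sub k 1 + 0 * x5Sub k 2
    simp only [x5Sub, mul_sub, sub_mul, mul_one, one_mul, ← map_mul, zero_mul,
      h1, mul_assoc, mul_inv_rev, inv_mul_cancel, mul_inv_cancel_left]
    abel
  · change x5Sub k 2 * grpP k (gen .x12) =
      0 * x5Sub k 0 + 0 * x5Sub k 1 + grpP k (gen .x12) * x5Sub k 2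
    simp only [x5Sub, mul_sub, sub_mul, mul_one, one_mul, ← map_mul, zero_mul,
      commute_x12_x35.eq]
    abel

theorem varpi_x23 : varpi k (basisJ5 k) (grpP k (gen .x23)) =
    !![grpP k (gen .x23), 0, 0;
      0, grpP k (gen .x23) * (1 + grpP k (x5 1 * x5 2) -
          grpP k (x5 1 * x5 2 * x5 1 * (x5 2)⁻¹ * (x5 1)⁻¹)),
        grpP k (gen .x23) * (grpP k (x5 1) - grpP k (x5 1 * x5 2 * x5 1 * (x5 2)⁻¹));
      0, grpP k (gen .x23) * (1 - grpP k (x5 1 * x5 2 * (x5 1)⁻¹)),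
        grpP k (gen .x23) * grpP k (x5 1)] := by
  have h1 := x23_conj 1 commute_x23_x25x35.1
  have h2 := x23_conj 2 commute_x23_x25x35.2
  rw [mul_assoc, inv_mul_eq_iff_eq_mul] at h1 h2
  funext i
  refine varpi_apply_eq k _ i _ ?_
  fin_cases i <;> rw [Fin.sum_univ_three]
  · change x5Sub k 0 * grpP k (gen .x23) =
      grpP k (gen .x23) * x5Sub k 0 + 0 * x5Sub k 1 + 0 * x5Sub k 2
    simp only [x5Sub, mul_sub, sub_mul, mul_one, one_mul, ← map_mul, zero_mul,
      commute_x23_x15.eq]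
    abel
  · change x5Sub k 1 * grpP k (gen .x23) = 0 * x5Sub k 0 +
        (grpP k (gen .x23) * (1 + grpP k (x5 1 * x5 2) -
          grpP k (x5 1 * x5 2 * x5 1 * (x5 2)⁻¹ * (x5 1)⁻¹))) * x5Sub k 1 +
        (grpP k (gen .x23) * (grpP k (x5 1) - grpP k (x5 1 * x5 2 * x5 1 * (x5 2)⁻¹))) *
        x5Sub k 2
    simp only [x5Sub, mul_sub, sub_mul, mul_add, add_mul, mul_one, one_mul, ← map_mul, zero_mul,
      h1, mul_assoc, mul_inv_rev, inv_mul_cancel]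
    abel
  · change x5Sub k 2 * grpP k (gen .x23) = 0 * x5Sub k 0 +
      (grpP k (gen .x23) * (1 - grpP k (x5 1 * x5 2 * (x5 1)⁻¹))) * x5Sub k 1 +
      (grpP k (gen .x23) * grpP k (x5 1)) * x5Sub k 2
    simp only [x5Sub, mul_sub, sub_mul, mul_one, one_mul, ← map_mul, zero_mul,
      h2, mul_assoc, mul_inv_rev, inv_mul_cancel, mul_inv_cancel_left]
    abel

theorem varpi_x5 (j : Fin 3) : varpi k (basisJ5 k) (grpP k (x5 j)) =
    Matrix.of fun i l => (if l = i then 1 else 0) + if l = j then x5Sub k i else 0 := by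
  funext i
  refine varpi_apply_eq k _ i _ ?_
  simp only [Matrix.of_apply, add_mul, Finset.sum_add_distrib, ite_mul, zero_mul, one_mul,
    Finset.sum_ite_eq', Finset.mem_univ, if_true]
  rw [x5Sub, x5Sub, mul_sub, mul_one]
  abel

/-- The decomposition into kernel and section gives this generating family, on which the matrices of
`ϖ` are known. -/
theorem generators_induction (H : Subgroup P5) (h12 : gen .x12 ∈ H) (h23 : gen .x23 ∈ H)
    (h5 : ∀ i, x5 i ∈ H) (g : P5) : g ∈ H := by
  rw [eq_iota_mul_ellGrp g]
  refine mul_mem ?_ ?_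
  · have h : iota.range ≤ H := by
      rw [iota, FreeGroup.range_lift_eq_closure, Subgroup.closure_le]
      rintro _ ⟨i, rfl⟩
      exact h5 i
    exact h ⟨_, rfl⟩
  · have h : ellGrp.range ≤ H := by
      rw [ellGrp, FreeGroup.range_lift_eq_closure, Subgroup.closure_le]
      rintro _ ⟨i, rfl⟩
      fin_cases i
      · exact h23
      · exact h12
    exact h ⟨_, rfl⟩

/-- The matrices of the generators all reduce to the identity under the augmentation, hence so does
that of every group element. This makes `ϖ` a filtered map. -/
theorem counit_varpi (p : KP k) :
    (Bialgebra.counitAlgHom k (KP k)).mapMatrix (varpi k (basisJ5 k) p) =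
      algebraMap k _ (Bialgebra.counitAlgHom k (KP k) p) := by
  have h : (Bialgebra.counitAlgHom k (KP k)).mapMatrix.comp (varpi k (basisJ5 k)) =
      (Algebra.ofId k (Matrix (Fin 3) (Fin 3) k)).comp (Bialgebra.counitAlgHom k (KP k)) := by
    refine algHom_ext_of k fun g => ?_
    let f : P5 →* Matrix (Fin 3) (Fin 3) k :=
      (((Bialgebra.counitAlgHom k (KP k)).mapMatrix.comp (varpi k (basisJ5 k)) :
        KP k →ₐ[k] Matrix (Fin 3) (Fin 3) k) : KP k →* Matrix (Fin 3) (Fin 3) k).comp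
        (MonoidAlgebra.of k P5)
    have hf : ∀ g, g ∈ f.ker := fun g => by
      refine generators_induction f.ker ?_ ?_ ?_ g
      · rw [MonoidHom.mem_ker]
        change (Bialgebra.counitAlgHom k (KP k)).mapMatrix (varpi k (basisJ5 k) (grpP k _)) = 1
        rw [varpi_x12]
        ext i j
        fin_cases i <;> fin_cases j <;> simp
      · rw [MonoidHom.mem_ker]
        change (Bialgebra.counitAlgHom k (KP k)).mapMatrix (varpi k (basisJ5 k) (grpP k _)) = 1
        rw [varpi_x23]
        ext i j
        fin_cases i <;> fin_cases j <;> simp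
      · intro j
        rw [MonoidHom.mem_ker]
        change (Bialgebra.counitAlgHom k (KP k)).mapMatrix (varpi k (basisJ5 k) (grpP k _)) = 1
        rw [varpi_x5]
        ext i l
        simp [x5Sub, Matrix.one_apply, eq_comm, apply_ite (Coalgebra.counit (R := k) (A := KP k))]
    refine (MonoidHom.mem_ker.1 (hf g)).trans ?_
    rw [AlgHom.comp_apply, counit_of, map_one]
  exact DFunLike.congr_fun h p

theorem counit_ell (a : KF k) :
    Bialgebra.counitAlgHom k (KP k) (ell k a) = Bialgebra.counitAlgHom k (KF k) a := by
  have h : (Bialgebra.counitAlgHom k (KP k)).comp (ell k) = Bialgebra.counitAlgHom k (KF k) :=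
    algHom_ext_of k fun g => by rw [AlgHom.comp_apply, ell_of, counit_of, counit_of]
  exact DFunLike.congr_fun h a

theorem pr12_of (g : P5) : pr12 k (grpP k g) = grp k (pr1 g) ⊗ₜ[k] grp k (pr2 g) := by
  simp [pr12]

theorem counit_pr12 (a : KP k) :
    Bialgebra.counitAlgHom k (KFKF k) (pr12 k a) = Bialgebra.counitAlgHom k (KP k) a := by
  have h : (Bialgebra.counitAlgHom k (KFKF k)).comp (pr12 k) = Bialgebra.counitAlgHom k (KP k) :=
    algHom_ext_of k fun g => by
      rw [AlgHom.comp_apply, pr12_of, counit_of]; simp [grp]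
  exact DFunLike.congr_fun h a

open AlgFiltration

theorem hasShift_ell : (filKF k).HasShift (filKP k) 0 (ell k).toLinearMap :=
  hasShift_augmentation _ _ fun a ha => mem_augmentation_one.2 (by rw [counit_ell, ha])

theorem hasShift_varpi :
    (filKP k).HasShift ((filKP k).matrix 3) 0 (varpi k (basisJ5 k)).toLinearMap :=
  hasShift_augmentation _ _ fun a ha i j => mem_augmentation_one.2 (by
    have h := congrFun (congrFun (counit_varpi k a) i) j
    rw [ha, map_zero] at h
    exact h)

theorem hasShift_pr12 : (filKP k).HasShift (filKFKF k) 0 (pr12 k).toLinearMap :=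
  hasShift_augmentation _ _ fun a ha => mem_augmentation_one.2 (by rw [counit_pr12, ha])

theorem hasShift_pr12Mat :
    ((filKP k).matrix 3).HasShift ((filKFKF k).matrix 3) 0 (pr12Mat k).toLinearMap :=
  fun n _ hM i j => hasShift_pr12 k n _ (hM i j)

theorem hasShift_rowCol : ((filKFKF k).matrix 3).HasShift (filKFKF k) 1 (rowCol k) := by
  intro n M hM
  have h1 : X1T k - 1 ∈ (filKFKF k).sub 1 := mem_augmentation_one.2 (by simp [X1T, grp])
  have h2 : 1 - Y1T k ∈ (filKFKF k).sub 1 := mem_augmentation_one.2 (by simp [Y1T, grp])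
  have hrow : ∀ j, row k 0 j ∈ (filKFKF k).sub 1 := by
    intro j
    fin_cases j
    · exact h1
    · exact h2
    · exact zero_mem _
  change (row k * M * col k) 0 0 ∈ _
  rw [Matrix.mul_apply]
  refine Submodule.sum_mem _ fun j _ => (filKFKF k).mul_mem_right _ _ ?_
  rw [Matrix.mul_apply, add_comm]
  exact Submodule.sum_mem _ fun i _ => (filKFKF k).mul_mem 1 n _ _ (hrow i) (hM i j)

end

section

/-! ### The top row of the diagram -/

variable (k : Type*) [CommRing k]

/-- The algebra morphism `k F₂ → M₃((k F₂)^{⊗ 2})` of the top row. -/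
def rho : KF k →ₐ[k] Matrix (Fin 3) (Fin 3) (KFKF k) :=
  (pr12Mat k).comp ((varpi k (basisJ5 k)).comp (ell k))

theorem pr1_x5 (i : Fin 3) : pr1 (x5 i) = ![1, X1, (X0 * X1)⁻¹] i := by
  fin_cases i
  · change pr1 (gen .x12 * gen .x13 * gen .x14)⁻¹ = 1
    simp [pr1_gen, pr1Fun]
  · change pr1 (gen .x12 * gen .x23 * gen .x24)⁻¹ = X1
    simp [pr1_gen, pr1Fun]
  · change pr1 (gen .x13 * gen .x23 * gen .x34)⁻¹ = (X0 * X1)⁻¹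
    simp [pr1_gen, pr1Fun]

theorem pr2_x5 (i : Fin 3) : pr2 (x5 i) = ![X1, 1, X1⁻¹ * X0 * X1] i := by
  fin_cases i
  · change pr2 (gen .x12 * gen .x13 * gen .x14)⁻¹ = X1
    simp [pr2_gen, pr2Fun]
  · change pr2 (gen .x12 * gen .x23 * gen .x24)⁻¹ = 1
    simp [pr2_gen, pr2Fun]
  · change pr2 (gen .x13 * gen .x23 * gen .x34)⁻¹ = X1⁻¹ * X0 * X1
    simp [pr2_gen, pr2Fun, mul_assoc]

/-- The element of `(k F₂)^{⊗ 2}` attached to a pair of elements of `F₂`. -/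
def grp2 (g h : F2) : KFKF k := grp k g ⊗ₜ[k] grp k h

theorem grp2_left (g : F2) : grp2 k g 1 = grp k g ⊗ₜ[k] 1 := by rw [grp2, grp_one]

theorem grp2_right (g : F2) : grp2 k 1 g = 1 ⊗ₜ[k] grp k g := by rw [grp2, grp_one]

theorem pr12_of' (g : P5) : pr12 k (grpP k g) = grp2 k (pr1 g) (pr2 g) := pr12_of k g

theorem grp2_mul (g h g' h' : F2) : grp2 k g h * grp2 k g' h' = grp2 k (g * g') (h * h') := by
  rw [grp2, grp2, grp2, grp_mul, grp_mul, Algebra.TensorProduct.tmul_mul_tmul]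

theorem grp2_one : grp2 k 1 1 = 1 := by
  rw [grp2_left, grp_one]; rfl

theorem tensor_mul_neg (a b : KFKF k) : a * -b = -(a * b) := mul_neg a b

theorem tensor_neg_mul (a b : KFKF k) : -a * b = -(a * b) := neg_mul a b

theorem rho_X1 : rho k (grp k X1) =
    !![1 + grp2 k X1 X1 - grp2 k 1 X1, grp2 k 1 X1 - grp2 k 1 (X1 * X1), 0;
      1 - grp2 k X1 1, grp2 k 1 X1, 0; 0, 0, 1] := by
  have h : rho k (grp k X1) = pr12Mat k (varpi k (basisJ5 k) (grpP k (gen .x12))) := by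
    rw [← ellGrp_X1, grpP, ← ell_of]; rfl
  rw [h, varpi_x12]
  funext i j
  change pr12 k (_ : KP k) = _
  fin_cases i <;> fin_cases j <;>
    simp only [Fin.zero_eta, Fin.mk_one, Fin.reduceFinMk, Matrix.of_apply, Matrix.cons_val,
      Matrix.cons_val_zero, Matrix.cons_val_one, map_add, map_sub, map_mul, map_zero,
      pr12_of', grp2_mul, pr1_gen, pr2_gen, pr1_x5, pr2_x5, pr1Fun, pr2Fun, map_inv, grp2_one,
      one_mul, mul_one, inv_one, mul_assoc, mul_inv_cancel, mul_add, mul_sub]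

theorem rho_X0 : rho k (grp k X0) =
    !![grp2 k X0 1, 0, 0;
      0, grp2 k X0 1 + grp2 k 1 (X1⁻¹ * X0 * X1) - grp2 k (X1 * X0) 1,
        grp2 k (X0 * X1) 1 - grp2 k (X1 * X0 * X1) 1;
      0, grp2 k X0 1 - grp2 k X1⁻¹ (X1⁻¹ * X0 * X1), grp2 k (X0 * X1) 1] := by
  have h : rho k (grp k X0) = pr12Mat k (varpi k (basisJ5 k) (grpP k (gen .x23))) := by
    rw [← ellGrp_X0, grpP, ← ell_of]; rfl
  rw [h, varpi_x23]
  funext i j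
  change pr12 k (_ : KP k) = _
  fin_cases i <;> fin_cases j <;>
    simp only [Fin.zero_eta, Fin.mk_one, Fin.reduceFinMk, Matrix.of_apply, Matrix.cons_val,
      Matrix.cons_val_zero, Matrix.cons_val_one, map_add, map_sub, map_mul, map_zero,
      pr12_of', grp2_mul, pr1_gen, pr2_gen, pr1_x5, pr2_x5, pr1Fun, pr2Fun, map_inv,
      one_mul, mul_one, inv_one, mul_assoc, mul_inv_cancel, mul_inv_cancel_left, mul_add, mul_sub,
      mul_inv_rev, inv_inv, inv_mul_cancel]

/-- The source of the whole diagram: the image of `X₁ - 1` is a rank one matrix, and `row`, `col`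
are its two factors. -/
theorem rho_e1 : rho k (e1 k) = col k * row k := by
  rw [e1, map_sub, map_one, rho_X1]
  funext i j
  have h1 : X1T k = grp2 k X1 1 := by rw [X1T, grp2_left]
  have h2 : Y1T k = grp2 k 1 X1 := by rw [Y1T, grp2_right]
  fin_cases i <;> fin_cases j <;>
    simp [col, row, h1, h2, mul_sub, grp2_mul, Matrix.mul_apply, tensor_neg_mul] <;> abel

/-- The linear map of the top row. -/
def topRow : KF k →ₗ[k] KFKF k := (rowCol k).comp (rho k).toLinearMap

theorem topRow_apply (f : KF k) : topRow k f = (row k * rho k f * col k) 0 0 := rfl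

/-- Inserting `ρ(X₁ - 1) = col · row` splits the product in the middle. -/
theorem topRow_mul (a b : KF k) : topRow k (a * e1 k * b) = topRow k a * topRow k b := by
  have h : row k * rho k (a * e1 k * b) * col k =
      (row k * rho k a * col k) * (row k * rho k b * col k) := by
    rw [map_mul, map_mul, rho_e1]
    simp only [Matrix.mul_assoc]
  rw [topRow_apply, topRow_apply, topRow_apply, h, Matrix.mul_apply, Fin.sum_univ_one]

/-- The column vector with coordinates `(a, w, X₁⁻¹ (z - w))`. -/
def vec3 (a z w : KFKF k) : Matrix (Fin 3) (Fin 1) (KFKF k) :=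
  !![a; w; grp2 k X1⁻¹ 1 * (z - w)]

theorem vec3_sub (a z w a' z' w' : KFKF k) :
    vec3 k (a - a') (z - z') (w - w') = vec3 k a z w - vec3 k a' z' w' := by
  funext i j
  fin_cases i <;> fin_cases j <;> simp [vec3, mul_sub]
  abel

theorem col_eq : col k = vec3 k (grp2 k 1 X1) (-1) (-1) := by
  funext i j
  fin_cases i <;> fin_cases j <;> simp [vec3, col, Y1T, grp2_right]

theorem row_mul_vec3 (a z w : KFKF k) :
    (row k * vec3 k a z w) 0 0 = (grp2 k X1 1 - 1) * a + (1 - grp2 k 1 X1) * w := by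
  simp [Matrix.mul_apply, Fin.sum_univ_three, row, vec3, X1T, Y1T, grp2_left, grp2_right]

/-- In the coordinates `(a, z, w)` the action of `X₀` is triangular: `a` and `z` are scaled by `X₀ ⊗
1`, `w` by `1 ⊗ X₁⁻¹ X₀ X₁`, and the only mixing is from `z` to `w`. -/
theorem rho_X0_mul_vec3 (a z w : KFKF k) :
    rho k (grp k X0) * vec3 k a z w = vec3 k (grp2 k X0 1 * a) (grp2 k X0 1 * z)
      (grp2 k 1 (X1⁻¹ * X0 * X1) * w + (1 - grp2 k X1 1) * (grp2 k X0 1 * z)) := by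
  rw [rho_X0]
  funext i j
  fin_cases i <;> fin_cases j <;>
    simp only [Matrix.mul_apply, Fin.sum_univ_three, vec3, Fin.zero_eta, Fin.mk_one,
      Fin.reduceFinMk, Matrix.of_apply, Matrix.cons_val, Matrix.cons_val_zero,
      Matrix.cons_val_one, mul_sub, sub_mul, add_mul, mul_add, zero_mul, add_zero, zero_add,
      ← mul_assoc, grp2_mul, one_mul, mul_one, inv_mul_cancel, mul_inv_cancel_right]
  all_goals abel

theorem rho_X0_inv_mul_vec3 (a z w : KFKF k) :
    rho k (grp k X0⁻¹) * vec3 k a z w = vec3 k (grp2 k X0⁻¹ 1 * a) (grp2 k X0⁻¹ 1 * z)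
      (grp2 k 1 (X1⁻¹ * X0⁻¹ * X1) * (w - (1 - grp2 k X1 1) * z)) := by
  have h : rho k (grp k X0) * vec3 k (grp2 k X0⁻¹ 1 * a) (grp2 k X0⁻¹ 1 * z)
      (grp2 k 1 (X1⁻¹ * X0⁻¹ * X1) * (w - (1 - grp2 k X1 1) * z)) = vec3 k a z w := by
    rw [rho_X0_mul_vec3]
    simp only [← mul_assoc, grp2_mul, mul_inv_cancel, mul_one, grp2_one, one_mul,
      mul_inv_cancel_right, inv_mul_cancel, sub_add_cancel]
  rw [← h, ← Matrix.mul_assoc, ← map_mul, ← grp_mul, inv_mul_cancel, grp_one, map_one,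
    Matrix.one_mul]

/-- Conjugation by `X₁⁻¹` on `k F₂`. -/
def conjX1 : KF k →ₐ[k] KF k := MonoidAlgebra.mapDomainAlgHom k k (MulAut.conj X1⁻¹).toMonoidHom

theorem conjX1_grp (g : F2) : conjX1 k (grp k g) = grp k (X1⁻¹ * g * X1) := by
  simp [conjX1, grp]

theorem conjX1_apply (a : KF k) : conjX1 k a = grp k X1⁻¹ * a * grp k X1 := by
  induction a using MonoidAlgebra.induction_on with
  | of g =>
    change conjX1 k (grp k g) = grp k X1⁻¹ * grp k g * grp k X1
    rw [conjX1_grp, grp_mul, grp_mul]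
  | add a b ha hb => rw [map_add, ha, hb, mul_add, add_mul]
  | smul c a ha => rw [map_smul, ha, mul_smul_comm, smul_mul_assoc]

/-- The sum `∑ p_i(X₀) ⊗ X₁⁻¹ p_{n-i}(X₀) X₁` for `0 < i < n`, with `p_n` as in `powX0`. -/
def sumPow (s : ℤˣ) (n : ℕ) : KFKF k :=
  ∑ i ∈ Finset.Ico 1 n, powX0 k s i ⊗ₜ[k] conjX1 k (powX0 k s (n - i))

theorem sumPow_succ (s : ℤˣ) {n : ℕ} (hn : 1 ≤ n) : sumPow k s (n + 1) =
    (grp2 k 1 (X1⁻¹ * X0 ^ (s : ℤ) * X1) - 1) * sumPow k s n +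
      powX0 k s n ⊗ₜ[k] grp k (X1⁻¹ * X0 ^ (s : ℤ) * X1) := by
  rw [sumPow, sumPow, Finset.sum_Ico_succ_top hn, Nat.add_sub_cancel_left, powX0_one, conjX1_grp,
    Finset.mul_sum]
  congr 1
  refine Finset.sum_congr rfl fun i hi => ?_
  rw [Finset.mem_Ico] at hi
  rw [Nat.sub_add_comm hi.2.le, powX0_succ k s (by omega), map_mul, map_sub, map_one, conjX1_grp,
    grp2_right, sub_mul, sub_mul, one_mul, one_mul, Algebra.TensorProduct.tmul_mul_tmul, one_mul,
    TensorProduct.tmul_sub]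

theorem commute_tmul_one_one_tmul (a b : KF k) :
    Commute (a ⊗ₜ[k] (1 : KF k)) ((1 : KF k) ⊗ₜ[k] b) := by
  rw [commute_iff_eq, Algebra.TensorProduct.tmul_mul_tmul, Algebra.TensorProduct.tmul_mul_tmul]
  simp

section

variable {R : Type*} [Ring R]

/-- The induction step for the coordinate `w`, with `t = 1 ⊗ X₁⁻¹ X₀ X₁`, `u = 1 - X₁ ⊗ 1`, `x = X₀
⊗ 1`, `p = p_n ⊗ 1`, `P = 1 ⊗ X₁⁻¹ p_n X₁` and `S = sumPow`. In the version below, `X₀` is replaced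
by its inverse. -/
theorem triangular_step (t x u P p S : R) (h : Commute t u) :
    t * (-P - u * (p + S)) + u * (x * -p) - (-P - u * (p + S)) =
      -(t * P - P) - u * ((x * p - p) + ((t - 1) * S + t * p)) := by
  rw [mul_sub, h.left_comm]
  noncomm_ring

theorem triangular_step_inv (t u P p S : R) (h : Commute t u) :
    t * (-P + u * (P + S) - u * -p) - (-P + u * (P + S)) =
      -(t * P - P) + u * ((t * P - P) + ((t - 1) * S + t * p)) := by
  rw [mul_sub, mul_add, h.left_comm, h.left_comm]
  noncomm_ring

end

/-- The coordinates `a` and `z` are merely multiplied by `p_n ⊗ 1`. The mixing of `z` into `w`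
accumulates the cross terms `p_i ⊗ X₁⁻¹ p_{n-i} X₁`, the future sum in the coproduct of `Y_n`, with
the boundary term `p_n ⊗ 1`. For the sign `-1` the boundary term is `1 ⊗ X₁⁻¹ p_n X₁` instead. -/
theorem rho_powX0_one {n : ℕ} (hn : 1 ≤ n) : rho k (powX0 k 1 n) * col k =
    vec3 k (powX0 k 1 n ⊗ₜ grp k X1) (-(powX0 k 1 n ⊗ₜ 1))
      (-(1 ⊗ₜ conjX1 k (powX0 k 1 n)) -
        (1 - grp2 k X1 1) * (powX0 k 1 n ⊗ₜ 1 + sumPow k 1 n)) := by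
  induction n, hn using Nat.le_induction with
  | base =>
    rw [powX0_one, conjX1_grp, sumPow, Finset.Ico_self, Finset.sum_empty, Units.val_one, zpow_one,
      col_eq, rho_X0_mul_vec3, grp2_mul, one_mul, mul_one, tensor_mul_neg,
      tensor_mul_neg, tensor_mul_neg, mul_one, mul_one, ← grp2_left, ← grp2_right, add_zero,
      ← sub_eq_add_neg]
    rfl
  | succ n hn ih =>
    have hx : powX0 k 1 (n + 1) = grp k X0 * powX0 k 1 n - powX0 k 1 n := by
      rw [powX0_succ k 1 hn, sub_mul, one_mul, Units.val_one, zpow_one]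
    have hc : Commute (grp2 k 1 (X1⁻¹ * X0 * X1)) (1 - grp2 k X1 1) := by
      rw [grp2_left, grp2_right]
      exact (Commute.one_right _).sub_right (commute_tmul_one_one_tmul k _ _).symm
    have hl : ∀ b : KF k, grp2 k X0 1 * (powX0 k 1 n ⊗ₜ[k] b) - powX0 k 1 n ⊗ₜ[k] b =
        powX0 k 1 (n + 1) ⊗ₜ[k] b := fun b => by
      rw [hx, grp2_left, Algebra.TensorProduct.tmul_mul_tmul, one_mul, TensorProduct.sub_tmul]
    have hr : ∀ a : KF k, grp2 k 1 (X1⁻¹ * X0 * X1) * (a ⊗ₜ[k] conjX1 k (powX0 k 1 n)) -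
        a ⊗ₜ[k] conjX1 k (powX0 k 1 n) = a ⊗ₜ[k] conjX1 k (powX0 k 1 (n + 1)) := fun a => by
      rw [hx, grp2_right, Algebra.TensorProduct.tmul_mul_tmul, one_mul, map_sub, map_mul,
        conjX1_grp, TensorProduct.tmul_sub]
    have hm : grp2 k 1 (X1⁻¹ * X0 * X1) * (powX0 k 1 n ⊗ₜ[k] 1) =
        powX0 k 1 n ⊗ₜ[k] grp k (X1⁻¹ * X0 * X1) := by
      rw [grp2_right, Algebra.TensorProduct.tmul_mul_tmul, one_mul, mul_one]
    rw [← hl, ← hl, ← hr, sumPow_succ k 1 hn, Units.val_one, zpow_one, ← hm, hx, map_sub, map_mul,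
      Matrix.sub_mul, Matrix.mul_assoc, ih, rho_X0_mul_vec3, ← vec3_sub]
    congr 1
    · rw [tensor_mul_neg]
      abel
    · exact triangular_step _ _ _ _ _ _ hc

theorem rho_powX0_neg_one {n : ℕ} (hn : 1 ≤ n) : rho k (powX0 k (-1) n) * col k =
    vec3 k (powX0 k (-1) n ⊗ₜ grp k X1) (-(powX0 k (-1) n ⊗ₜ 1))
      (-(1 ⊗ₜ conjX1 k (powX0 k (-1) n)) +
        (1 - grp2 k X1 1) * (1 ⊗ₜ conjX1 k (powX0 k (-1) n) + sumPow k (-1) n)) := by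
  have hc : Commute (grp2 k 1 (X1⁻¹ * X0⁻¹ * X1)) (1 - grp2 k X1 1) := by
    rw [grp2_left, grp2_right]
    exact (Commute.one_right _).sub_right (commute_tmul_one_one_tmul k _ _).symm
  induction n, hn using Nat.le_induction with
  | base =>
    rw [powX0_one, conjX1_grp, sumPow, Finset.Ico_self, Finset.sum_empty, Units.val_neg,
      Units.val_one, zpow_neg_one,
      col_eq, rho_X0_inv_mul_vec3, grp2_mul, one_mul, mul_one, tensor_mul_neg,
      tensor_mul_neg, mul_one, mul_one, ← grp2_left, ← grp2_right, add_zero, sub_neg_eq_add,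
      mul_add, tensor_mul_neg, mul_one, hc.eq]
    rfl
  | succ n hn ih =>
    have hx : powX0 k (-1) (n + 1) = grp k X0⁻¹ * powX0 k (-1) n - powX0 k (-1) n := by
      rw [powX0_succ k (-1) hn, sub_mul, one_mul, Units.val_neg, Units.val_one, zpow_neg_one]
    have hl : ∀ b : KF k, grp2 k X0⁻¹ 1 * (powX0 k (-1) n ⊗ₜ[k] b) - powX0 k (-1) n ⊗ₜ[k] b =
        powX0 k (-1) (n + 1) ⊗ₜ[k] b := fun b => by
      rw [hx, grp2_left, Algebra.TensorProduct.tmul_mul_tmul, one_mul, TensorProduct.sub_tmul]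
    have hr : ∀ a : KF k, grp2 k 1 (X1⁻¹ * X0⁻¹ * X1) * (a ⊗ₜ[k] conjX1 k (powX0 k (-1) n)) -
        a ⊗ₜ[k] conjX1 k (powX0 k (-1) n) = a ⊗ₜ[k] conjX1 k (powX0 k (-1) (n + 1)) := fun a => by
      rw [hx, grp2_right, Algebra.TensorProduct.tmul_mul_tmul, one_mul, map_sub, map_mul,
        conjX1_grp, TensorProduct.tmul_sub]
    have hm : grp2 k 1 (X1⁻¹ * X0⁻¹ * X1) * (powX0 k (-1) n ⊗ₜ[k] 1) =
        powX0 k (-1) n ⊗ₜ[k] grp k (X1⁻¹ * X0⁻¹ * X1) := by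
      rw [grp2_right, Algebra.TensorProduct.tmul_mul_tmul, one_mul, mul_one]
    rw [← hl, ← hl, ← hr, sumPow_succ k (-1) hn, Units.val_neg, Units.val_one, zpow_neg_one, ← hm,
      hx, map_sub, map_mul, Matrix.sub_mul, Matrix.mul_assoc, ih, rho_X0_inv_mul_vec3, ← vec3_sub]
    congr 1
    · rw [tensor_mul_neg]
      abel
    · exact triangular_step_inv _ _ _ _ _ hc

theorem topRow_eq_of_mul_col {f : KF k} {a z w : KFKF k} (h : rho k f * col k = vec3 k a z w) :
    topRow k f = (grp2 k X1 1 - 1) * a + (1 - grp2 k 1 X1) * w := by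
  rw [topRow_apply, Matrix.mul_assoc, h, row_mul_vec3]

theorem topRow_one : topRow k 1 = grp2 k X1 X1 - 1 := by
  rw [topRow_eq_of_mul_col k (f := 1) (by rw [map_one, Matrix.one_mul, col_eq]), sub_mul, grp2_mul,
    one_mul, mul_one, one_mul, tensor_mul_neg, mul_one]
  abel

end

section

/-! ### The coproduct -/

section

variable {R : Type*} [Ring R]

/-- Here `y = X₁ ⊗ 1` and `z = 1 ⊗ X₁`. The left side is the prescribed coproduct of `Y_n^+` seen
through `psi`, the right side minus the value of the top row. -/
theorem coproduct_identity (y z p c S : R) (h : Commute z y) :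
    (1 - y) * p + (1 - z) * c + (1 - y) * ((1 - z) * S) =
      -((y - 1) * (z * p) + (1 - z) * (-c - (1 - y) * (p + S))) := by
  have h1 : ∀ q, z * (y * q) = y * (z * q) := h.left_comm
  simp only [sub_mul, mul_sub, mul_add, one_mul, mul_neg, h1]
  abel

theorem coproduct_identity_inv (y z p c S : R) (h : Commute z y) :
    (y - 1) * (z * p) + y * ((z - 1) * c) + (y - 1) * ((z - 1) * S) =
      (y - 1) * (z * p) + (1 - z) * (-c + (1 - y) * (c + S)) := by
  have h1 : ∀ q, z * (y * q) = y * (z * q) := h.left_comm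
  simp only [sub_mul, mul_sub, mul_add, one_mul, mul_neg, h1]
  abel

end

variable (k : Type*) [CommRing k]

/-- The algebra isomorphism `Ad(X₁ - 1)`. -/
abbrev adE1 : Wl k →ₐ[k] Wr k := adLeft k (e1 k) (isRightRegular_e1 k)

/-- The morphism `incl ∘ Ad(Y₁⁻¹) ∘ Ad(X₁ - 1)^{⊗ 2}`. -/
def psi : Wl k ⊗[k] Wl k →ₐ[k] KFKF k :=
  (inclRight k).comp ((conj (A := Wr k ⊗[k] Wr k) k (Y1r k)⁻¹).comp
    (Algebra.TensorProduct.map (adE1 k) (adE1 k)))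

theorem psi_tmul (a b : Wl k) :
    psi k (a ⊗ₜ b) = (adE1 k a : KF k) ⊗ₜ[k] conjX1 k (adE1 k b) := by
  have h : psi k (a ⊗ₜ b) =
      inclRight k ((1 ⊗ₜ X1r k (-1)) * (adE1 k a ⊗ₜ adE1 k b) * (1 ⊗ₜ X1r k 1)) := rfl
  rw [h, map_mul, map_mul, conjX1_apply]
  simp [inclRight, X1r]

/-- `Ad(X₁ - 1)` is bijective because `X₁ - 1` is regular on both sides; conjugation by a unit and
`incl` are injective. -/
theorem psi_injective : Function.Injective (psi k) := by
  have h := adLeft_bijective (k := k) (isRightRegular_e1 k) (isLeftRegular_e1 k)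
  have h1 : Function.Injective (Algebra.TensorProduct.map (adE1 k) (adE1 k)) :=
    (TensorProduct.congr (LinearEquiv.ofBijective (adE1 k).toLinearMap h)
      (LinearEquiv.ofBijective (adE1 k).toLinearMap h)).injective
  have h2 := conj_injective (k := k) (A := Wr k ⊗[k] Wr k) (Y1r k)⁻¹
  exact fun x y hxy => h1 (h2 (inclRight_injective k hxy))

theorem psi_delta (Δ : Wl k →ₐ[k] Wl k ⊗[k] Wl k) (f : KF k) :
    inclRight k (bottom k Δ (mor k (twist k f))) =
      psi k (Δ (leftIncl k (e1 k) (mor k (twist k f)))) := rfl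

theorem adE1_X1l (s : ℤˣ) : (adE1 k (X1l k s) : KF k) = grp k (X1 ^ (s : ℤ)) := by
  refine adLeft_eq (k := k) _ ?_
  change grp k (X1 ^ (s : ℤ)) * e1 k = e1 k * grp k (X1 ^ (s : ℤ))
  rw [e1, mul_sub, sub_mul, ← grp_mul, ← grp_mul, mul_one, one_mul, ← zpow_add_one, ← zpow_one_add,
    add_comm]

theorem adE1_Yl_one (n : ℕ) :
    (adE1 k (Yl k 1 n) : KF k) = (1 - grp k X1) * powX0 k 1 n := by
  refine adLeft_eq (k := k) _ ?_
  rw [coe_Yl, Units.val_one, zpow_one, e1]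
  noncomm_ring

/-- Right multiplication by `X₁` turns the factor `1 - X₁⁻¹` of `Y_n^-` into `X₁ - 1`. The case of
`Y_n^-` is therefore treated after multiplying by `X₁`, and by `X₁ ⊗ X₁` in the tensor square. -/
theorem adE1_Yl_neg_one_mul (n : ℕ) :
    (adE1 k (Yl k (-1) n * X1l k 1) : KF k) = e1 k * powX0 k (-1) n ∧
      ((Yl k (-1) n * X1l k 1 : Wl k) : KF k) = powX0 k (-1) n * e1 k := by
  have h : ((Yl k (-1) n * X1l k 1 : Wl k) : KF k) = powX0 k (-1) n * e1 k := by
    change powX0 k (-1) n * (1 - grp k (X1 ^ ((-1 : ℤˣ) : ℤ))) * grp k (X1 ^ ((1 : ℤˣ) : ℤ)) = _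
    rw [mul_assoc, sub_mul, ← grp_mul, one_mul, Units.val_neg, Units.val_one, zpow_neg_one,
      zpow_one, inv_mul_cancel, grp_one, e1]
  refine ⟨adLeft_eq (k := k) _ ?_, h⟩
  rw [h, mul_assoc]

theorem conjX1_e1 : conjX1 k (e1 k) = e1 k := by
  rw [e1, map_sub, conjX1_grp, map_one, inv_mul_cancel, one_mul]

theorem commute_grp2 (g h : F2) : Commute (grp2 k 1 h) (grp2 k g 1) := by
  rw [commute_iff_eq, grp2_mul, grp2_mul, one_mul, mul_one, one_mul, mul_one]

/-- The right-hand side of the formula for `Δ_♯(Y_n^s)`. -/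
def coproductY (s : ℤˣ) (n : ℕ) : Wl k ⊗[k] Wl k :=
  Yl k s n ⊗ₜ[k] 1 + 1 ⊗ₜ[k] Yl k s n + ∑ i ∈ Finset.Ico 1 n, Yl k s i ⊗ₜ[k] Yl k s (n - i)

theorem psi_X1l (s : ℤˣ) :
    psi k (X1l k s ⊗ₜ X1l k s) = grp2 k (X1 ^ (s : ℤ)) (X1 ^ (s : ℤ)) := by
  rw [psi_tmul, adE1_X1l, conjX1_grp, mul_assoc, ← zpow_add_one, ← zpow_neg_one, ← zpow_add,
    neg_add_cancel_comm_assoc]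
  rfl

theorem psi_coproductY_one {n : ℕ} (hn : 1 ≤ n) :
    psi k (coproductY k 1 n) = -topRow k (powX0 k 1 n) := by
  rw [topRow_eq_of_mul_col k (rho_powX0_one k hn), coproductY, map_add, map_add, map_sum]
  simp only [psi_tmul, adE1_Yl_one, map_one, OneMemClass.coe_one]
  have hl : ∀ a : KF k, ((1 - grp k X1) * a) ⊗ₜ[k] (1 : KF k) =
      (1 - grp2 k X1 1) * (a ⊗ₜ[k] 1) := fun a => by
    rw [grp2_left, sub_mul, sub_mul, TensorProduct.sub_tmul, Algebra.TensorProduct.tmul_mul_tmul,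
      one_mul, one_mul, one_mul]
  have hr : ∀ a b : KF k, b ⊗ₜ[k] conjX1 k ((1 - grp k X1) * a) =
      (1 - grp2 k 1 X1) * (b ⊗ₜ[k] conjX1 k a) := fun a b => by
    rw [grp2_right, map_mul, map_sub, map_one, conjX1_grp, inv_mul_cancel, one_mul, sub_mul,
      sub_mul, TensorProduct.tmul_sub, Algebra.TensorProduct.tmul_mul_tmul, one_mul, one_mul,
      one_mul]
  have hs : ∀ a b : KF k, ((1 - grp k X1) * a) ⊗ₜ[k] b =
      (1 - grp2 k X1 1) * (a ⊗ₜ[k] b) := fun a b => by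
    rw [grp2_left, sub_mul, sub_mul, TensorProduct.sub_tmul, Algebra.TensorProduct.tmul_mul_tmul,
      one_mul, one_mul, one_mul]
  have hp : powX0 k 1 n ⊗ₜ[k] grp k X1 = grp2 k 1 X1 * (powX0 k 1 n ⊗ₜ[k] 1) := by
    rw [grp2_right, Algebra.TensorProduct.tmul_mul_tmul, one_mul, mul_one]
  have hsum : ∑ i ∈ Finset.Ico 1 n, ((1 - grp k X1) * powX0 k 1 i) ⊗ₜ[k]
      conjX1 k ((1 - grp k X1) * powX0 k 1 (n - i)) =
      (1 - grp2 k X1 1) * ((1 - grp2 k 1 X1) * sumPow k 1 n) := by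
    rw [sumPow, Finset.mul_sum, Finset.mul_sum]
    exact Finset.sum_congr rfl fun i _ => by rw [hs, hr]
  rw [hsum, hs, hr, hp]
  exact coproduct_identity _ _ _ _ _ (commute_grp2 k X1 X1)

theorem psi_coproductY_neg_one {n : ℕ} (hn : 1 ≤ n) :
    psi k (coproductY k (-1) n * (X1l k 1 ⊗ₜ X1l k 1)) = topRow k (powX0 k (-1) n) := by
  rw [topRow_eq_of_mul_col k (rho_powX0_neg_one k hn), coproductY, add_mul, add_mul,
    Finset.sum_mul, map_add, map_add, map_sum]
  simp only [Algebra.TensorProduct.tmul_mul_tmul, psi_tmul, (adE1_Yl_neg_one_mul k _).1, one_mul,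
    adE1_X1l, Units.val_one, zpow_one]
  have hr : ∀ a b : KF k, b ⊗ₜ[k] conjX1 k (e1 k * a) =
      (grp2 k 1 X1 - 1) * (b ⊗ₜ[k] conjX1 k a) := fun a b => by
    rw [grp2_right, map_mul, conjX1_e1, e1, sub_mul,
      sub_mul, TensorProduct.tmul_sub, Algebra.TensorProduct.tmul_mul_tmul, one_mul, one_mul,
      one_mul]
  have hs : ∀ a b : KF k, (e1 k * a) ⊗ₜ[k] b =
      (grp2 k X1 1 - 1) * (a ⊗ₜ[k] b) := fun a b => by
    rw [grp2_left, e1, sub_mul, sub_mul, TensorProduct.sub_tmul,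
      Algebra.TensorProduct.tmul_mul_tmul, one_mul, one_mul, one_mul]
  have hp : powX0 k (-1) n ⊗ₜ[k] grp k X1 = grp2 k 1 X1 * (powX0 k (-1) n ⊗ₜ[k] 1) := by
    rw [grp2_right, Algebra.TensorProduct.tmul_mul_tmul, one_mul, mul_one]
  have hp' : ∀ b, grp k X1 ⊗ₜ[k] b = grp2 k X1 1 * ((1 : KF k) ⊗ₜ[k] b) := fun b => by
    rw [grp2_left, Algebra.TensorProduct.tmul_mul_tmul, one_mul, mul_one]
  have hsum : ∑ i ∈ Finset.Ico 1 n, (e1 k * powX0 k (-1) i) ⊗ₜ[k]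
      conjX1 k (e1 k * powX0 k (-1) (n - i)) =
      (grp2 k X1 1 - 1) * ((grp2 k 1 X1 - 1) * sumPow k (-1) n) := by
    rw [sumPow, Finset.mul_sum, Finset.mul_sum]
    exact Finset.sum_congr rfl fun i _ => by rw [hs, hr]
  rw [hsum, hs, hp' (conjX1 k _), hr, conjX1_grp, inv_mul_cancel, one_mul, hp]
  exact coproduct_identity_inv _ _ _ _ _ (commute_grp2 k X1 X1)

theorem algHom_ext_Wl {B : Type*} [Semiring B] [Algebra k B] {F G : Wl k →ₐ[k] B}
    (h1 : ∀ s, F (X1l k s) = G (X1l k s)) (h2 : ∀ s n, 1 ≤ n → F (Yl k s n) = G (Yl k s n)) :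
    F = G := by
  have h := eq_top_of_generators_mem k (AlgHom.equalizer F G) h1 h2
  ext1 w
  have hw : w ∈ AlgHom.equalizer F G := h ▸ trivial
  exact hw

theorem X1l_neg_one_mul : X1l k (-1) * X1l k 1 = 1 :=
  Subtype.ext (by simp [X1l, grp, MonoidAlgebra.one_def])

theorem exists_delta : ∃ Δ : Wl k →ₐ[k] Wl k ⊗[k] Wl k, IsDeltaSharp k Δ ∧
    ∀ f, inclRight k (bottom k Δ (mor k (twist k f))) = topRow k f := by
  obtain ⟨Φ, hΦ⟩ := exists_leftSub_lift (isRightRegular_e1 k)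
    (Bialgebra.counitAlgHom k (KF k)) (counit_e1 k) (topRow k) (topRow_mul k)
  have hΦ' : ∀ (w : Wl k) a, (w : KF k) = a * e1 k → Φ w = topRow k a := by
    rintro ⟨_, h⟩ a rfl
    have h3 := hΦ 0 a (by rw [map_zero, zero_add]; exact h)
    simp only [map_zero, zero_add] at h3
    exact h3
  have hinv : grp2 k X1 X1 * grp2 k X1⁻¹ X1⁻¹ = 1 := by
    rw [grp2_mul, mul_inv_cancel, grp2_one]
  have hcancel : ∀ a b : KFKF k, a * grp2 k X1 X1 = b * grp2 k X1 X1 → a = b := fun a b h => by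
    have h3 := congrArg (· * grp2 k X1⁻¹ X1⁻¹) h
    simpa only [mul_assoc, hinv, mul_one] using h3
  have hX1 : Φ (X1l k 1) = psi k (X1l k 1 ⊗ₜ X1l k 1) := by
    have h3 := hΦ 1 1 ⟨1, 1, rfl⟩
    rw [topRow_one, map_one (algebraMap k (KFKF k)), add_sub_cancel] at h3
    rw [psi_X1l, Units.val_one, zpow_one, ← h3]
    refine congrArg Φ (Subtype.ext ?_)
    change grp k (X1 ^ ((1 : ℤˣ) : ℤ)) = algebraMap k (KF k) 1 + 1 * e1 k
    rw [map_one, one_mul, e1, Units.val_one, zpow_one, add_sub_cancel]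
  have hX1' : psi k (X1l k 1 ⊗ₜ X1l k 1) = grp2 k X1 X1 := by
    rw [psi_X1l, Units.val_one, zpow_one]
  have hX : ∀ s, Φ (X1l k s) = psi k (X1l k s ⊗ₜ X1l k s) := by
    intro s
    rcases Int.units_eq_one_or s with rfl | rfl
    · exact hX1
    -- After multiplication by the invertible `X₁ ⊗ X₁`, both sides become `1`.
    · refine hcancel _ _ ?_
      rw [← hX1', ← map_mul, ← hX1, ← map_mul, Algebra.TensorProduct.tmul_mul_tmul,
        X1l_neg_one_mul, map_one, ← Algebra.TensorProduct.one_def, map_one]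
  have hY : ∀ s n, 1 ≤ n → Φ (Yl k s n) = psi k (coproductY k s n) := by
    intro s n hn
    rcases Int.units_eq_one_or s with rfl | rfl
    · rw [psi_coproductY_one k hn, ← map_neg]
      refine hΦ' _ _ ?_
      rw [coe_Yl, Units.val_one, zpow_one, e1]
      noncomm_ring
    · refine hcancel _ _ ?_
      rw [← hX1', ← map_mul, ← hX1, ← map_mul, psi_coproductY_neg_one k hn]
      exact hΦ' _ _ (adE1_Yl_neg_one_mul k n).2
  -- The preimage of the image of `psi` is a subalgebra containing the generators, so `Φ` can be
  -- divided by the injective `psi`.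
  have hrange : (psi k).range.comap Φ = ⊤ :=
    eq_top_of_generators_mem k _ (fun s => ⟨_, (hX s).symm⟩)
      (fun s n hn => ⟨_, (hY s n hn).symm⟩)
  have hmem : ∀ w, Φ w ∈ (psi k).range := fun w => by
    have hw : w ∈ (psi k).range.comap Φ := hrange ▸ trivial
    exact hw
  let E := AlgEquiv.ofInjective (psi k) (psi_injective k)
  let Δ : Wl k →ₐ[k] Wl k ⊗[k] Wl k := E.symm.toAlgHom.comp (Φ.codRestrict _ hmem)
  have hΔ : ∀ w, psi k (Δ w) = Φ w := fun w =>
    congrArg Subtype.val (E.apply_symm_apply ⟨Φ w, hmem w⟩)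
  refine ⟨Δ, fun s => ⟨?_, fun n hn => ?_⟩, fun f => ?_⟩
  · exact psi_injective k ((hΔ _).trans (hX s))
  · exact psi_injective k ((hΔ _).trans (hY s n hn))
  · rw [psi_delta, hΔ]
    exact hΦ' _ _ rfl

theorem hasShift_topRow : (filKF k).HasShift (filKFKF k) 1 (topRow k) := fun n a ha =>
  hasShift_rowCol k n _ (hasShift_pr12Mat k n _ (hasShift_varpi k n _ (hasShift_ell k n a ha)))

/-- If `f (X₁ - 1) ∈ I^{n+1}` then `f ∈ I^n`, and the top row sends `f` to filtration `n + 1`: the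
two shifts cancel, and strictness of `incl` brings the result back to the tensor filtration. -/
theorem hasShift_bottom {Δ : Wl k →ₐ[k] Wl k ⊗[k] Wl k}
    (h : ∀ f, inclRight k (bottom k Δ (mor k (twist k f))) = topRow k f) :
    (filWlPlus k).HasShift ((filWr k).tensor (filWr k)) 0 (toLin (bottom k Δ)) := by
  rintro n ⟨_, f, rfl⟩ ha
  refine mem_tensor_of_inclRight k ?_
  have h1 : inclRight k (toLin (bottom k Δ) ⟨f * e1 k, f, rfl⟩) = topRow k f := h f
  rw [h1, add_zero]
  cases n with
  | zero => rw [(filKFKF k).sub_zero]; trivial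
  | succ n => exact hasShift_topRow k n f (mem_of_mul_e1_mem k ha)

end

end BettiBraid

end

open BettiBraid
theorem mainTheorem10 (k : Type*) [CommRing k] [Algebra ℚ k] :
    ∃ (b : Module.Basis (Fin 3) (KP k) (J5 k)) (Δ : Wl k →ₐ[k] Wl k ⊗[k] Wl k),
      -- the basis of `Ker(pr₅)` and the coproduct are the intended ones
      (∀ i, (b i : KP k) = x5Sub k i) ∧
      (∀ D : Wl k →ₐ[k] Wl k ⊗[k] Wl k, IsDeltaSharp k D ↔ D = Δ) ∧
      -- the left vertical arrow is an isomorphism and the right one an injection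
      Function.Bijective (mor k) ∧
      Function.Injective (inclRight k) ∧
      -- the diagram commutes
      (∀ f : KF k, inclRight k (bottom k Δ (mor k (twist k f))) =
        rowCol k (pr12Mat k (varpi k b (ell k f)))) ∧
      -- the arrows are weakly compatible with the filtrations
      ∃ (hell : (filKF k).HasShift (filKP k) 0 (ell k).toLinearMap)
        (hvarpi : (filKP k).HasShift ((filKP k).matrix 3) 0 (varpi k b).toLinearMap)
        (hpr : ((filKP k).matrix 3).HasShift ((filKFKF k).matrix 3) 0 (pr12Mat k).toLinearMap)
        (hrc : ((filKFKF k).matrix 3).HasShift (filKFKF k) 1 (rowCol k))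
        (htw : (filKF k).HasShift (filTwisted k) 1 (twist k : KF k →ₗ[k] Twisted (e1 k)))
        (hmor : (filTwisted k).HasShift (filWlPlus k) 0 (toLin (mor k)))
        (hbot : (filWlPlus k).HasShift ((filWr k).tensor (filWr k)) 0
          (toLin (bottom k Δ)))
        (hincl : ((filWr k).tensor (filWr k)).HasShift (filKFKF k) 0
          (inclRight k).toLinearMap),
        -- the completed diagram of continuous linear maps commutes
        (∀ x : (filKF k).completion,
          hincl.map (hbot.map (hmor.map (htw.map x))) =
            hrc.map (hpr.map (hvarpi.map (hell.map x)))) ∧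
        -- the completions of the algebra morphisms are multiplicative
        (∀ x y, hell.map (x * y) = hell.map x * hell.map y) ∧
        (∀ x y, hvarpi.map (x * y) = hvarpi.map x * hvarpi.map y) ∧
        (∀ x y, hpr.map (x * y) = hpr.map x * hpr.map y) ∧
        (∀ x y, hmor.map (x * y) = hmor.map x * hmor.map y) ∧
        (∀ x y, hbot.map (x * y) = hbot.map x * hbot.map y) ∧
        (∀ x y, hincl.map (x * y) = hincl.map x * hincl.map y) := by
  refine (exists_delta k).elim fun Δ h => ?_
  have hΔ := h.1
  have hcomm := h.2
  have hcomm' : ∀ f : KF k, inclRight k (bottom k Δ (mor k (twist k f))) =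
      rowCol k (pr12Mat k (varpi k (basisJ5 k) (ell k f))) := hcomm
  have hbot := hasShift_bottom k hcomm
  refine ⟨basisJ5 k, Δ, basisJ5_apply k, fun D => ⟨fun hD => ?_, fun h => h ▸ hΔ⟩,
    mor_bijective k, inclRight_injective k, hcomm', hasShift_ell k, hasShift_varpi k,
    hasShift_pr12Mat k, hasShift_rowCol k, hasShift_twist k, hasShift_mor k,
    hbot, hasShift_inclRight k, fun x => ?_, ?_, ?_, ?_, ?_, ?_, ?_⟩
  · exact algHom_ext_Wl k (fun s => (hD s).1.trans (hΔ s).1.symm)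
      fun s n hn => ((hD s).2 n hn).trans ((hΔ s).2 n hn).symm
  · refine Subtype.ext (funext fun n => ?_)
    -- At level `n` both composites are computed on a common representative `a`, where the
    -- uncompleted diagram applies.
    obtain ⟨a, ha⟩ := ((filKF k).sub n).mkQ_surjective (x.1 n)
    have hL := (hasShift_inclRight k).mkQ_eq_map_apply ((hbot).mkQ_eq_map_apply
      ((hasShift_mor k).mkQ_eq_map_apply ((hasShift_twist k).mkQ_eq_map_apply ha)))
    have hR := (hasShift_rowCol k).mkQ_eq_map_apply ((hasShift_pr12Mat k).mkQ_eq_map_apply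
      ((hasShift_varpi k).mkQ_eq_map_apply ((hasShift_ell k).mkQ_eq_map_apply ha)))
    exact hL.symm.trans ((congrArg ((filKFKF k).sub n).mkQ (hcomm a)).trans hR)
  · exact (hasShift_ell k).map_mul (map_mul (ell k))
  · exact (hasShift_varpi k).map_mul (map_mul (varpi k (basisJ5 k)))
  · exact (hasShift_pr12Mat k).map_mul (map_mul (pr12Mat k))
  · exact (hasShift_mor k).map_mul (map_mul (mor k))
  · exact hbot.map_mul (map_mul (bottom k Δ))
  · exact (hasShift_inclRight k).map_mul (map_mul (inclRight k))
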